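/- Let $X$ be a proper metric space and let $\mathscr{H}$ be an ample $X$-module: a complex Hilbert space with a non-degenerate $*$-representation of $C_0(X)$ in which only $f=0$ acts as a compact operator. For a Borel set $W\subseteq X$ let $\chi_W$ denote also the projection on $\mathscr{H}$ by which the indicator function of $W$ acts under the extension of the representation to bounded Borel functions. The Roe algebra $C^*_{\mathrm{Roe}}(X)\subseteq B(\mathscr{H})$ is the norm closure of the $*$-algebra of all operators $T$ that are locally compact ($\chi_WT$ and $T\chi_W$ are compact for all bounded Borel sets $W$) and of finite propagation (there is $r\ge 0$ with $\chi_VT\chi_W=0$ for all Borel sets $V,W$ with $d(V,W)>r$). For $Y\subseteq X$ put $B_r(Y)=\{x : d(x,y)\le r \text{ for some } y\in Y\}$, let $\{Y\}$ be the family of all sets contained in some $B_r(Y)$, $r>0$, and let the coarse boundary be $\partial Y=\{A\cap B : A\in\{Y\},\ B\in\{X\setminus Y\}\}$. Let $C^*_{\mathrm{Roe}}(\partial Y)$ be the closure of the set of all $T\in C^*_{\mathrm{Roe}}(X)$ for which there is $Z\in\partial Y$ such that $fT=Tf=0$ for all $f\in C_0(X)$ with support in $X\setminus Z$, and let $C^*_{\mathrm{Roe}}(\partial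 Y)^+$ be its unitalization. Let $Y,W\subseteq X$ be Borel sets that are transversal: $Z\cap Z'$ is bounded for all $Z\in\partial Y$, $Z'\in\partial W$. For a unitary $u\in C^*_{\mathrm{Roe}}(\partial Y)^+\otimes M_n(\mathbb{C})$, acting on $\mathscr{H}^n$, and with $\chi_W$ acting diagonally on $\mathscr{H}^n$, put $$F_u=\chi_Wu\chi_W+\chi_{X\setminus W}.$$ Then $F_u$ is a Fredholm operator on $\mathscr{H}^n$ whose index depends only on the class $[u]\in K_1(C^*_{\mathrm{Roe}}(\partial Y))$ (the stable homotopy class of $u$ among unitaries in matrix algebras over the unitalization), so that $\theta_W([u])=\operatorname{ind}(F_u)$ defines a map $\theta_W:K_1(C^*_{\mathrm{Roe}}(\partial Y))\to\mathbb{Z}$. If $u[\chi_W,u^*]$ is trace class, then $$\theta_W([u])=\operatorname{Tr}\bigl(u[\chi_W,u^*]\bigr).$$ -/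

import Mathlib

open scoped InnerProductSpace ZeroAtInfty

universe u v

noncomputable section

namespace RoeKubo

/-! ### Trace-class operators and Fredholm operators on a Hilbert space -/

section Operators

variable {E : Type u} [NormedAddCommGroup E] [InnerProductSpace ℂ E] [CompleteSpace E]

/-- `T` is trace class: `∑ ⟨e_i, |T| e_i⟩ < ∞` for an orthonormal basis `(e_i)`, where
`|T| = (T* T)^{1/2}`. The terms are nonnegative, and the choice of the basis does not matter. -/
def IsTraceClass (T : E →L[ℂ] E) : Prop :=
  ∃ (ι : Type u) (b : HilbertBasis ι ℂ E), Summable fun i => ⟪b i, CFC.abs T (b i)⟫_ℂ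

/-- `Tr T = z`: the sum `∑ ⟨e_i, T e_i⟩` converges (unconditionally) to `z` for every orthonormal
basis `(e_i)`. -/
def HasTrace (T : E →L[ℂ] E) (z : ℂ) : Prop :=
  ∀ (ι : Type u) (b : HilbertBasis ι ℂ E), HasSum (fun i => ⟪b i, T (b i)⟫_ℂ) z

/-- Finite-dimensional kernel and cokernel (the range is then automatically closed). -/
def IsFredholm (F : E →L[ℂ] E) : Prop :=
  FiniteDimensional ℂ (LinearMap.ker (F : E →ₗ[ℂ] E)) ∧
    FiniteDimensional ℂ (E ⧸ LinearMap.range (F : E →ₗ[ℂ] E))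

/-- `dim ker F - dim coker F`. -/
def fredholmIndex (F : E →L[ℂ] E) : ℤ :=
  (Module.finrank ℂ (LinearMap.ker (F : E →ₗ[ℂ] E)) : ℤ) -
    Module.finrank ℂ (E ⧸ LinearMap.range (F : E →ₗ[ℂ] E))

/-- The operator on `E^n = E ⊕ ⋯ ⊕ E` given by an `n × n` matrix of operators on `E`. -/
def blockOp {n : ℕ} (M : Matrix (Fin n) (Fin n) (E →L[ℂ] E)) :
    PiLp 2 (fun _ : Fin n => E) →L[ℂ] PiLp 2 (fun _ : Fin n => E) :=
  ((PiLp.continuousLinearEquiv 2 ℂ (fun _ : Fin n => E)).symm :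
      (Fin n → E) →L[ℂ] PiLp 2 (fun _ : Fin n => E)) ∘L
    ContinuousLinearMap.pi fun i => ∑ j, M i j ∘L PiLp.proj 2 (fun _ : Fin n => E) j

end Operators

/-! ### Modules over a metric space

An `X`-module is a Hilbert space `H` with an action `ρ` of the C⋆-algebra `C₀(X)`. -/

section XModule

variable {X : Type v} [MetricSpace X]
variable {H : Type u} [NormedAddCommGroup H] [InnerProductSpace ℂ H] [CompleteSpace H]

/-- The closed subspace of `H` spanned by all `f ξ` with `f ∈ C₀(X)` vanishing outside `U` and
`ξ ∈ H`. -/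
def essentialSubspace (ρ : C₀(X, ℂ) →⋆ₙₐ[ℂ] (H →L[ℂ] H)) (U : Set X) : Submodule ℂ H :=
  (Submodule.span ℂ {η | ∃ f : C₀(X, ℂ), (∀ x ∉ U, f x = 0) ∧ ∃ ξ : H, η = ρ f ξ}).topologicalClosure

/-- The action is non-degenerate: `C₀(X) H` is total in `H`. -/
def IsNondegenerate (ρ : C₀(X, ℂ) →⋆ₙₐ[ℂ] (H →L[ℂ] H)) : Prop :=
  essentialSubspace ρ Set.univ = ⊤

/-- Only `f = 0` acts as a compact operator. -/
def IsAmple (ρ : C₀(X, ℂ) →⋆ₙₐ[ℂ] (H →L[ℂ] H)) : Prop :=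
  ∀ f : C₀(X, ℂ), IsCompactOperator (ρ f) → f = 0

/-- The range of `χ_W`. -/
def spectralSubspace (ρ : C₀(X, ℂ) →⋆ₙₐ[ℂ] (H →L[ℂ] H)) (W : Set X) : Submodule ℂ H :=
  ⨅ U : {U : Set X // IsOpen U ∧ W ⊆ U}, essentialSubspace ρ U.1

theorem isClosed_spectralSubspace (ρ : C₀(X, ℂ) →⋆ₙₐ[ℂ] (H →L[ℂ] H)) (W : Set X) :
    IsClosed (spectralSubspace ρ W : Set H) := by
  rw [spectralSubspace, Submodule.coe_iInf]
  exact isClosed_iInter fun U => Submodule.isClosed_topologicalClosure _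

instance (ρ : C₀(X, ℂ) →⋆ₙₐ[ℂ] (H →L[ℂ] H)) (W : Set X) :
    (spectralSubspace ρ W).HasOrthogonalProjection :=
  haveI : CompleteSpace (spectralSubspace ρ W) :=
    (isClosed_spectralSubspace ρ W).completeSpace_coe
  inferInstance

/-- The operator by which the indicator function `χ_W` of a Borel set `W` acts on `H`, under the
extension of the action from `C₀(X)` to bounded Borel functions (the value at `W` of the spectral
measure of `ρ`). For `U` open, `χ_U` is the supremum of the operators `f` with `0 ≤ f ≤ 1` in
`C₀(X)` vanishing outside `U`, that is, the projection onto the closure of `C₀(U) H`; for `W` Borel,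
`χ_W` is the infimum of the projections `χ_U` over the open sets `U ⊇ W`, since finite Borel
measures on a metric space are outer regular. -/
def chi (ρ : C₀(X, ℂ) →⋆ₙₐ[ℂ] (H →L[ℂ] H)) (W : Set X) : H →L[ℂ] H :=
  (spectralSubspace ρ W).starProjection

/-- `χ_W T` and `T χ_W` are compact for all bounded Borel sets `W`. -/
def IsLocallyCompact [MeasurableSpace X] (ρ : C₀(X, ℂ) →⋆ₙₐ[ℂ] (H →L[ℂ] H))
    (T : H →L[ℂ] H) : Prop :=
  ∀ W : Set X, MeasurableSet W → Bornology.IsBounded W →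
    IsCompactOperator (chi ρ W * T) ∧ IsCompactOperator (T * chi ρ W)

/-- For some `r ≥ 0`, `χ_V T χ_W = 0` for all Borel sets `V`, `W` with `d(V, W) > r`. -/
def HasFinitePropagation [MeasurableSpace X] (ρ : C₀(X, ℂ) →⋆ₙₐ[ℂ] (H →L[ℂ] H))
    (T : H →L[ℂ] H) : Prop :=
  ∃ r : ℝ, 0 ≤ r ∧ ∀ V W : Set X, MeasurableSet V → MeasurableSet W →
    ENNReal.ofReal r < (⨅ x ∈ V, ⨅ y ∈ W, edist x y) → chi ρ V * T * chi ρ W = 0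

/-- The Roe algebra of `X`: the norm closure of the algebra of locally compact operators of finite
propagation (these already form a ⋆-algebra, so that `adjoin` adds nothing). -/
def roeAlgebra [MeasurableSpace X] (ρ : C₀(X, ℂ) →⋆ₙₐ[ℂ] (H →L[ℂ] H)) :
    NonUnitalStarSubalgebra ℂ (H →L[ℂ] H) :=
  (NonUnitalStarAlgebra.adjoin ℂ
    {T : H →L[ℂ] H | IsLocallyCompact ρ T ∧ HasFinitePropagation ρ T}).topologicalClosure

/-- `T` is supported in the family `𝒴`: there is `Z ∈ 𝒴` with `f T = T f = 0` for all `f` with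
support in `X ∖ Z`. -/
def IsSupportedIn (ρ : C₀(X, ℂ) →⋆ₙₐ[ℂ] (H →L[ℂ] H)) (𝒴 : Set (Set X)) (T : H →L[ℂ] H) : Prop :=
  ∃ Z ∈ 𝒴, ∀ f : C₀(X, ℂ), tsupport f ⊆ Zᶜ → ρ f * T = 0 ∧ T * ρ f = 0

/-- The Roe algebra localized at a big family `𝒴`: the closure of the operators in the Roe algebra
that are supported in `𝒴` (for a big family they form a ⋆-algebra, so that `adjoin` adds
nothing). -/
def localizedRoeAlgebra [MeasurableSpace X] (ρ : C₀(X, ℂ) →⋆ₙₐ[ℂ] (H →L[ℂ] H))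
    (𝒴 : Set (Set X)) : NonUnitalStarSubalgebra ℂ (H →L[ℂ] H) :=
  (NonUnitalStarAlgebra.adjoin ℂ
    {T : H →L[ℂ] H | T ∈ roeAlgebra ρ ∧ IsSupportedIn ρ 𝒴 T}).topologicalClosure

end XModule

/-! ### Big families -/

section Coarse

variable {X : Type v} [MetricSpace X]

/-- `B_r(Y)`. -/
def neighborhood (r : ℝ) (Y : Set X) : Set X := {x | ∃ y ∈ Y, dist x y ≤ r}

/-- The big family `{Y}` of all sets contained in a uniform thickening of `Y`. -/
def thickenings (Y : Set X) : Set (Set X) := {Z | ∃ r : ℝ, 0 < r ∧ Z ⊆ neighborhood r Y}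

/-- The intersection of two big families: all intersections of members. -/
def interFamily (𝒴 𝒵 : Set (Set X)) : Set (Set X) := Set.image2 (fun A B => A ∩ B) 𝒴 𝒵

/-- The coarse boundary `∂Y = {Y} ∩ {X ∖ Y}`. -/
def coarseBoundary (Y : Set X) : Set (Set X) := interFamily (thickenings Y) (thickenings Yᶜ)

/-- `Y` and `W` are transversal: every member of `∂Y ∩ ∂W` is bounded. -/
def AreTransversal (Y W : Set X) : Prop :=
  ∀ Z ∈ interFamily (coarseBoundary Y) (coarseBoundary W), Bornology.IsBounded Z

end Coarse

/-! ### The `K₁`-group, as a set of classes of unitaries, and the index map -/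

section KTheory

variable {H : Type u} [NormedAddCommGroup H] [InnerProductSpace ℂ H] [CompleteSpace H]

/-- The unitary group of `A⁺ ⊗ M_n(ℂ)`, with `A⁺` the unitalization of `A`. -/
abbrev UnitaryOver (A : NonUnitalStarSubalgebra ℂ (H →L[ℂ] H)) (n : ℕ) : Type u :=
  unitary (Matrix (Fin n) (Fin n) (Unitization ℂ A))

/-- The block sum `u ⊕ 1_{N-n}` of an `n × n` matrix `u`, for `n ≤ N`. -/
def stabilize {R : Type u} [Zero R] [One R] {n : ℕ} (N : ℕ) (u : Matrix (Fin n) (Fin n) R) :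
    Matrix (Fin N) (Fin N) R :=
  Matrix.of fun i j =>
    if h : i.1 < n ∧ j.1 < n then u ⟨i.1, h.1⟩ ⟨j.1, h.2⟩ else if i = j then 1 else 0

/-- `u` and `v` are stably homotopic: for some `N`, `u ⊕ 1` and `v ⊕ 1` are joined by a norm
continuous path of unitaries in `A⁺ ⊗ M_N(ℂ)`. -/
def StablyHomotopic (A : NonUnitalStarSubalgebra ℂ (H →L[ℂ] H))
    (u v : Σ n : ℕ, UnitaryOver A n) : Prop :=
  ∃ N : ℕ, u.1 ≤ N ∧ v.1 ≤ N ∧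
    ∃ γ : C(unitInterval, Matrix (Fin N) (Fin N) (Unitization ℂ A)),
      (∀ t, γ t ∈ unitary (Matrix (Fin N) (Fin N) (Unitization ℂ A))) ∧
        γ 0 = stabilize N u.2.1 ∧ γ 1 = stabilize N v.2.1

/-- `K₁(A)`: stable homotopy classes of unitaries in the matrix algebras over `A⁺`. -/
def K1 (A : NonUnitalStarSubalgebra ℂ (H →L[ℂ] H)) : Type u := Quot (StablyHomotopic A)

/-- The class `[u]` in `K₁(A)`. -/
def K1.mk {A : NonUnitalStarSubalgebra ℂ (H →L[ℂ] H)} {n : ℕ} (u : UnitaryOver A n) : K1 A :=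
  Quot.mk _ ⟨n, u⟩

/-- The operator on `H^n` given by a unitary `u ∈ A⁺ ⊗ M_n(ℂ)`, where `A⁺` acts on `H` through
`λ + a ↦ λ 1 + a`. -/
def unitaryOp {A : NonUnitalStarSubalgebra ℂ (H →L[ℂ] H)} {n : ℕ} (u : UnitaryOver A n) :
    PiLp 2 (fun _ : Fin n => H) →L[ℂ] PiLp 2 (fun _ : Fin n => H) :=
  blockOp (u.1.map (NonUnitalStarSubalgebra.unitization A))

variable {X : Type v} [MetricSpace X]

/-- `χ_W` acting diagonally on `H^n`. -/
def chiN (ρ : C₀(X, ℂ) →⋆ₙₐ[ℂ] (H →L[ℂ] H)) (n : ℕ) (W : Set X) :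
    PiLp 2 (fun _ : Fin n => H) →L[ℂ] PiLp 2 (fun _ : Fin n => H) :=
  blockOp (Matrix.diagonal fun _ => chi ρ W)

/-- `F_u = χ_W u χ_W + χ_{X ∖ W}`. -/
def toeplitzOp (ρ : C₀(X, ℂ) →⋆ₙₐ[ℂ] (H →L[ℂ] H)) (W : Set X)
    {A : NonUnitalStarSubalgebra ℂ (H →L[ℂ] H)} {n : ℕ} (u : UnitaryOver A n) :
    PiLp 2 (fun _ : Fin n => H) →L[ℂ] PiLp 2 (fun _ : Fin n => H) :=
  chiN ρ n W * unitaryOp u * chiN ρ n W + chiN ρ n Wᶜ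

/-- The map `θ_W : K₁(A) → ℤ`, `[u] ↦ ind F_u`: the index of `F_u` for a representative `u` of the
class. The index does not depend on the representative. -/
def theta (ρ : C₀(X, ℂ) →⋆ₙₐ[ℂ] (H →L[ℂ] H)) (W : Set X)
    (A : NonUnitalStarSubalgebra ℂ (H →L[ℂ] H)) (c : K1 A) : ℤ :=
  fredholmIndex (toeplitzOp ρ W (Quot.out c).2)

end KTheory

end RoeKubo

end

/-!
Write `P = χ_W` and let `u` be a unitary over the localized algebra. Transversality makes
`[P, a]` compact for every `a` in the localized Roe algebra, so the compressions of `u` and `u*`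
to the range of `P` are inverse to each other modulo compact operators: `F_u` is Fredholm, and its
index is invariant under norm continuous paths and under stabilization.

For the trace formula put `Q = u P u*`, so that `u [P, u*] = Q - P`. The self-adjoint operators
`A = Q - P` and `B = 1 - P - Q` satisfy `A B + B A = 0` and `A² + B² = 1`. Hence `B` carries the
eigenspace of `A` for `λ` onto the one for `-λ` when `λ² ≠ 1`, and these contributions to the trace
cancel. What is left is `dim ker (A - 1) - dim ker (A + 1)`, and these two eigenspaces are
isomorphic to the kernels of `F_u` and `F_{u*}`.
-/

noncomputable section

namespace RoeKubo

/-! ### The index of a linear map -/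

section LinearIndex

variable {K : Type*} [Field K] {V₁ V₂ V₃ : Type*} [AddCommGroup V₁] [Module K V₁]
  [AddCommGroup V₂] [Module K V₂] [AddCommGroup V₃] [Module K V₃]

/-- The index `dim ker f - dim coker f` of a linear map; an infinite dimension counts as `0`. -/
def linearIndex (f : V₁ →ₗ[K] V₂) : ℤ :=
  (Module.finrank K (LinearMap.ker f) : ℤ) - Module.finrank K (V₂ ⧸ LinearMap.range f)

theorem linearIndex_eq_finrank_sub_finrank [FiniteDimensional K V₁] [FiniteDimensional K V₂]
    (f : V₁ →ₗ[K] V₂) :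
    linearIndex f = (Module.finrank K V₁ : ℤ) - Module.finrank K V₂ := by
  have h₁ := f.finrank_range_add_finrank_ker
  have h₂ := (LinearMap.range f).finrank_quotient_add_finrank
  rw [linearIndex]
  omega

theorem finrank_inf_ker_add_finrank_map (f : V₁ →ₗ[K] V₂) (p : Submodule K V₁)
    [FiniteDimensional K p] :
    Module.finrank K (p ⊓ LinearMap.ker f : Submodule K V₁) + Module.finrank K (p.map f) =
      Module.finrank K p := by
  rw [← LinearMap.range_domRestrict, ← Submodule.map_comap_subtype, ← LinearMap.ker_domRestrict,
    Submodule.finrank_map_subtype_eq, add_comm]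
  exact (f.domRestrict p).finrank_range_add_finrank_ker

theorem finiteDimensional_ker_comp (f : V₂ →ₗ[K] V₃) (g : V₁ →ₗ[K] V₂)
    [FiniteDimensional K (LinearMap.ker f)] [FiniteDimensional K (LinearMap.ker g)] :
    FiniteDimensional K (LinearMap.ker (f ∘ₗ g)) := by
  rw [← Submodule.fg_iff_finiteDimensional, LinearMap.ker_comp]
  refine Submodule.fg_of_fg_map_of_fg_inf_ker g ?_ ?_ <;>
    rw [Submodule.fg_iff_finiteDimensional]
  · exact Submodule.finiteDimensional_of_le (Submodule.map_comap_le g _)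
  · exact Submodule.finiteDimensional_of_le inf_le_right

theorem finrank_ker_comp (f : V₂ →ₗ[K] V₃) (g : V₁ →ₗ[K] V₂)
    [FiniteDimensional K (LinearMap.ker f)] [FiniteDimensional K (LinearMap.ker g)] :
    Module.finrank K (LinearMap.ker (f ∘ₗ g)) = Module.finrank K (LinearMap.ker g) +
      Module.finrank K (LinearMap.range g ⊓ LinearMap.ker f : Submodule K V₂) := by
  have := finiteDimensional_ker_comp f g
  rw [← finrank_inf_ker_add_finrank_map g (LinearMap.ker (f ∘ₗ g)),
    inf_eq_right.2 (LinearMap.ker_le_ker_comp g f), LinearMap.ker_comp, Submodule.map_comap_eq]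

theorem finiteDimensional_quotient_map (f : V₁ →ₗ[K] V₂) (p : Submodule K V₁)
    [FiniteDimensional K (V₂ ⧸ LinearMap.range f)] [FiniteDimensional K (V₁ ⧸ p)] :
    FiniteDimensional K (V₂ ⧸ p.map f) := by
  have : FiniteDimensional K ((LinearMap.range f).map (p.map f).mkQ) := by
    rw [← Submodule.range_mapQ p (p.map f) f (Submodule.le_comap_map _ _)]
    infer_instance
  have := (Submodule.quotientQuotientEquivQuotient (p.map f) (LinearMap.range f)
    LinearMap.map_le_range).symm.finiteDimensional
  exact Module.Finite.of_submodule_quotient ((LinearMap.range f).map (p.map f).mkQ)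

theorem finrank_quotient_map_add_finrank_ker (f : V₁ →ₗ[K] V₂) (p : Submodule K V₁)
    [FiniteDimensional K (LinearMap.ker f)] [FiniteDimensional K (V₂ ⧸ LinearMap.range f)]
    [FiniteDimensional K (V₁ ⧸ p)] :
    Module.finrank K (V₂ ⧸ p.map f) + Module.finrank K (LinearMap.ker f) =
      Module.finrank K (V₂ ⧸ LinearMap.range f) + Module.finrank K (V₁ ⧸ p) +
        Module.finrank K (p ⊓ LinearMap.ker f : Submodule K V₁) := by
  have := finiteDimensional_quotient_map f p
  have hp : p ≤ (p.map f).comap f := Submodule.le_comap_map _ _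
  have hker := finrank_inf_ker_add_finrank_map p.mkQ (LinearMap.ker f)
  have hmapQ := (p.mapQ (p.map f) f hp).finrank_range_add_finrank_ker
  have hcoker := ((LinearMap.range f).map (p.map f).mkQ).finrank_quotient_add_finrank
  rw [Submodule.ker_mkQ, inf_comm] at hker
  rw [Submodule.range_mapQ, Submodule.ker_mapQ, Submodule.comap_map_eq, Submodule.map_sup,
    Submodule.mkQ_map_self, bot_sup_eq] at hmapQ
  rw [(Submodule.quotientQuotientEquivQuotient (p.map f) (LinearMap.range f)
    LinearMap.map_le_range).finrank_eq] at hcoker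
  omega

theorem linearIndex_comp (f : V₂ →ₗ[K] V₃) (g : V₁ →ₗ[K] V₂)
    [FiniteDimensional K (LinearMap.ker f)] [FiniteDimensional K (V₃ ⧸ LinearMap.range f)]
    [FiniteDimensional K (LinearMap.ker g)] [FiniteDimensional K (V₂ ⧸ LinearMap.range g)] :
    linearIndex (f ∘ₗ g) = linearIndex f + linearIndex g := by
  have hker := finrank_ker_comp f g
  have hcoker := finrank_quotient_map_add_finrank_ker f (LinearMap.range g)
  rw [← LinearMap.range_comp] at hcoker
  simp only [linearIndex]
  omega

/-- The isomorphism `ker (1 + a b) ≃ ker (1 + b a)` induced by `b`. -/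
def kerOneAddCompEquiv (a : V₂ →ₗ[K] V₁) (b : V₁ →ₗ[K] V₂) :
    LinearMap.ker (1 + a ∘ₗ b : V₁ →ₗ[K] V₁) ≃ₗ[K] LinearMap.ker (1 + b ∘ₗ a : V₂ →ₗ[K] V₂) where
  __ := b.restrict (p := LinearMap.ker (1 + a ∘ₗ b)) (q := LinearMap.ker (1 + b ∘ₗ a))
    fun x hx => by
      have hx : x + a (b x) = 0 := hx
      change b x + b (a (b x)) = 0
      rw [← map_add, hx, map_zero]
  invFun := (-a).restrict (p := LinearMap.ker (1 + b ∘ₗ a)) (q := LinearMap.ker (1 + a ∘ₗ b))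
    fun y hy => by
      have hy : y + b (a y) = 0 := hy
      change -a y + a (b (-a y)) = 0
      rw [map_neg, map_neg, ← neg_add, ← map_add, hy, map_zero, neg_zero]
  left_inv x := Subtype.ext (neg_eq_of_add_eq_zero_left x.2)
  right_inv y := Subtype.ext <| (map_neg b _).trans (neg_eq_of_add_eq_zero_left y.2)

/-- The isomorphism `coker (1 + a b) ≃ coker (1 + b a)` induced by `b`. -/
def cokerOneAddCompEquiv (a : V₂ →ₗ[K] V₁) (b : V₁ →ₗ[K] V₂) :
    (V₁ ⧸ LinearMap.range (1 + a ∘ₗ b : V₁ →ₗ[K] V₁)) ≃ₗ[K]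
      V₂ ⧸ LinearMap.range (1 + b ∘ₗ a : V₂ →ₗ[K] V₂) :=
  LinearEquiv.ofLinearMap
    (Submodule.mapQ _ _ b <| by rintro _ ⟨x, rfl⟩; exact ⟨b x, by simp⟩)
    (Submodule.mapQ _ _ (-a) <| by rintro _ ⟨y, rfl⟩; exact ⟨-a y, by simp [add_comm]⟩)
    (by
      ext y
      exact (Submodule.Quotient.eq _).2 ⟨-y, by simp; abel⟩)
    (by
      ext x
      exact (Submodule.Quotient.eq _).2 ⟨-x, by simp; abel⟩)

theorem linearIndex_one_add_comp_comm (a : V₂ →ₗ[K] V₁) (b : V₁ →ₗ[K] V₂) :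
    linearIndex (1 + a ∘ₗ b : V₁ →ₗ[K] V₁) = linearIndex (1 + b ∘ₗ a : V₂ →ₗ[K] V₂) := by
  rw [linearIndex, linearIndex, (kerOneAddCompEquiv a b).finrank_eq,
    (cokerOneAddCompEquiv a b).finrank_eq]

end LinearIndex

/-! ### Fredholm operators on a Hilbert space -/

section Fredholm

variable {E : Type u} [NormedAddCommGroup E] [InnerProductSpace ℂ E] {S T : E →L[ℂ] E}

theorem fredholmIndex_eq_linearIndex (T : E →L[ℂ] E) :
    fredholmIndex T = linearIndex (T : E →ₗ[ℂ] E) := rfl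

theorem IsFredholm.mul (hS : IsFredholm S) (hT : IsFredholm T) : IsFredholm (S * T) := by
  obtain ⟨_, _⟩ := hS
  obtain ⟨_, _⟩ := hT
  refine ⟨finiteDimensional_ker_comp (S : E →ₗ[ℂ] E) (T : E →ₗ[ℂ] E), ?_⟩
  rw [ContinuousLinearMap.toLinearMap_mul, Module.End.mul_eq_comp, LinearMap.range_comp]
  exact finiteDimensional_quotient_map _ _

theorem fredholmIndex_mul (hS : IsFredholm S) (hT : IsFredholm T) :
    fredholmIndex (S * T) = fredholmIndex S + fredholmIndex T := by
  obtain ⟨_, _⟩ := hS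
  obtain ⟨_, _⟩ := hT
  rw [fredholmIndex_eq_linearIndex, ContinuousLinearMap.toLinearMap_mul, Module.End.mul_eq_comp,
    linearIndex_comp]
  rfl

theorem IsFredholm.one_add_of_finiteDimensional_range
    [FiniteDimensional ℂ (LinearMap.range (T : E →ₗ[ℂ] E))] : IsFredholm (1 + T) :=
  let t := (T : E →ₗ[ℂ] E)
  ⟨(kerOneAddCompEquiv (LinearMap.range t).subtype t.rangeRestrict).symm.finiteDimensional,
    (cokerOneAddCompEquiv (LinearMap.range t).subtype t.rangeRestrict).symm.finiteDimensional⟩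

theorem fredholmIndex_one_add_of_finiteDimensional_range
    [FiniteDimensional ℂ (LinearMap.range (T : E →ₗ[ℂ] E))] : fredholmIndex (1 + T) = 0 := by
  let t := (T : E →ₗ[ℂ] E)
  have h : ((1 + T : E →L[ℂ] E) : E →ₗ[ℂ] E) =
      1 + (LinearMap.range t).subtype ∘ₗ t.rangeRestrict := rfl
  rw [fredholmIndex_eq_linearIndex, h, linearIndex_one_add_comp_comm,
    linearIndex_eq_finrank_sub_finrank, sub_self]

end Fredholm

/-! ### Compact perturbations -/

section Compact

variable {E : Type u} [NormedAddCommGroup E] [InnerProductSpace ℂ E] {k d S T : E →L[ℂ] E}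

theorem exists_finiteDimensional_norm_sub_lt (hk : IsCompactOperator k)
    {ε : ℝ} (hε : 0 < ε) :
    ∃ V : Submodule ℂ E, ∃ _ : FiniteDimensional ℂ V, ‖k - V.starProjection * k‖ < ε := by
  have himage := (hk.isCompact_closure_image_closedBall (f := (k : E →ₗ[ℂ] E)) 1).totallyBounded
  obtain ⟨t, htf, ht⟩ := Metric.totallyBounded_iff.1 (himage.subset subset_closure) (ε / 2)
    (half_pos hε)
  have : FiniteDimensional ℂ (Submodule.span ℂ t) := FiniteDimensional.span_of_finite ℂ htf
  refine ⟨Submodule.span ℂ t, this, lt_of_le_of_lt ?_ (half_lt_self hε)⟩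
  refine ContinuousLinearMap.opNorm_le_of_unit_norm (half_pos hε).le fun x hx => ?_
  obtain ⟨y, hy, hxy⟩ := Set.mem_iUnion₂.1 (ht ⟨x, mem_closedBall_zero_iff.2 hx.le, rfl⟩)
  calc ‖k x - (Submodule.span ℂ t).starProjection (k x)‖
      = ⨅ z : Submodule.span ℂ t, ‖k x - z‖ := Submodule.starProjection_minimal _
    _ ≤ ‖k x - y‖ := ciInf_le ⟨0, Set.forall_mem_range.2 fun _ => norm_nonneg _⟩
      (⟨y, Submodule.subset_span hy⟩ : Submodule.span ℂ t)
    _ ≤ ε / 2 := by rw [← dist_eq_norm]; exact (Metric.mem_ball.1 hxy).le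

theorem isCompactOperator_starProjection (V : Submodule ℂ E) [FiniteDimensional ℂ V] :
    IsCompactOperator V.starProjection :=
  ((isCompactOperator_id_iff_finiteDimensional.2 ‹FiniteDimensional ℂ V›).clm_comp
    V.subtypeL).comp_clm V.orthogonalProjectionOnto

/-- `S` is a parametrix of `T`: an inverse of `T` modulo compact operators. -/
structure IsParametrix (S T : E →L[ℂ] E) : Prop where
  left : IsCompactOperator (S * T - 1 : E →L[ℂ] E)
  right : IsCompactOperator (T * S - 1 : E →L[ℂ] E)

theorem IsParametrix.symm (h : IsParametrix S T) : IsParametrix T S := ⟨h.right, h.left⟩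

variable [CompleteSpace E]

theorem isCompactOperator_star (hk : IsCompactOperator k) :
    IsCompactOperator (star k : E →L[ℂ] E) := by
  have hclosed : IsClosed {T : E →L[ℂ] E | IsCompactOperator T} :=
    isClosed_setOfPred_isCompactOperator
  refine hclosed.closure_subset (Metric.mem_closure_iff.2 fun ε hε => ?_)
  obtain ⟨V, _, hV⟩ := exists_finiteDimensional_norm_sub_lt hk hε
  refine ⟨star k * V.starProjection, (isCompactOperator_starProjection V).clm_comp (star k), ?_⟩
  rwa [dist_eq_norm, ← norm_star, star_sub, star_mul, star_star,
    (isSelfAdjoint_starProjection V).star_eq]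

theorem isFredholm_of_isUnit (hT : IsUnit T) : IsFredholm T := by
  have hbij := ContinuousLinearMap.isUnit_iff_bijective.1 hT
  rw [IsFredholm, LinearMap.ker_eq_bot.2 hbij.1, LinearMap.range_eq_top.2 hbij.2]
  exact ⟨inferInstance, inferInstance⟩

theorem fredholmIndex_of_isUnit (hT : IsUnit T) : fredholmIndex T = 0 := by
  have hbij := ContinuousLinearMap.isUnit_iff_bijective.1 hT
  rw [fredholmIndex, LinearMap.ker_eq_bot.2 hbij.1, LinearMap.range_eq_top.2 hbij.2, finrank_bot,
    Module.finrank_zero_of_subsingleton, sub_self]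

theorem exists_isUnit_mul_one_add_finiteDimensional_range (hk : IsCompactOperator k)
    (hd : ‖d‖ < 1) :
    ∃ w r : E →L[ℂ] E, IsUnit w ∧ FiniteDimensional ℂ (LinearMap.range (r : E →ₗ[ℂ] E)) ∧
      1 + k + d = w * (1 + r) := by
  obtain ⟨V, _, hV⟩ := exists_finiteDimensional_norm_sub_lt hk (sub_pos.2 hd)
  have hnorm : ‖-(d + (k - V.starProjection * k))‖ < 1 := by
    rw [norm_neg]
    exact (norm_add_le _ _).trans_lt (by linarith)
  obtain ⟨w, hw⟩ := isUnit_one_sub_of_norm_lt_one hnorm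
  refine ⟨w, ↑w⁻¹ * (V.starProjection * k), w.isUnit, ?_, ?_⟩
  · have hle : LinearMap.range ((↑w⁻¹ * (V.starProjection * k) : E →L[ℂ] E) : E →ₗ[ℂ] E) ≤
        V.map ((↑w⁻¹ : E →L[ℂ] E) : E →ₗ[ℂ] E) := by
      rintro _ ⟨x, rfl⟩
      exact ⟨V.starProjection (k x), Submodule.starProjection_apply_mem _ _, rfl⟩
    exact Submodule.finiteDimensional_of_le hle
  · rw [mul_add, mul_one, Units.mul_inv_cancel_left, hw]
    abel

theorem isFredholm_one_add_add (hk : IsCompactOperator k) (hd : ‖d‖ < 1) :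
    IsFredholm (1 + k + d) := by
  obtain ⟨w, r, hw, _, h⟩ := exists_isUnit_mul_one_add_finiteDimensional_range hk hd
  rw [h]
  exact (isFredholm_of_isUnit hw).mul .one_add_of_finiteDimensional_range

theorem fredholmIndex_one_add_add (hk : IsCompactOperator k) (hd : ‖d‖ < 1) :
    fredholmIndex (1 + k + d) = 0 := by
  obtain ⟨w, r, hw, _, h⟩ := exists_isUnit_mul_one_add_finiteDimensional_range hk hd
  rw [h, fredholmIndex_mul (isFredholm_of_isUnit hw) .one_add_of_finiteDimensional_range,
    fredholmIndex_of_isUnit hw, fredholmIndex_one_add_of_finiteDimensional_range, add_zero]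

namespace IsParametrix

theorem isFredholm (h : IsParametrix S T) : IsFredholm T := by
  have hST := isFredholm_one_add_add (d := 0) h.left (by simp)
  have hTS := isFredholm_one_add_add (d := 0) h.right (by simp)
  rw [add_zero, add_sub_cancel, IsFredholm, ContinuousLinearMap.toLinearMap_mul,
    Module.End.mul_eq_comp] at hST hTS
  obtain ⟨_, -⟩ := hST
  obtain ⟨-, _⟩ := hTS
  exact ⟨Submodule.finiteDimensional_of_le
      (LinearMap.ker_le_ker_comp (T : E →ₗ[ℂ] E) (S : E →ₗ[ℂ] E)),
    Module.Finite.of_surjective _ (Submodule.factor_surjective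
      (LinearMap.range_comp_le_range (S : E →ₗ[ℂ] E) (T : E →ₗ[ℂ] E)))⟩

theorem fredholmIndex_add_of_norm_mul_lt (h : IsParametrix S T) {T' : E →L[ℂ] E}
    (hT' : IsFredholm T') (hnorm : ‖S * (T' - T)‖ < 1) :
    fredholmIndex S + fredholmIndex T' = 0 := by
  rw [← fredholmIndex_mul h.symm.isFredholm hT', ← fredholmIndex_one_add_add h.left hnorm, mul_sub]
  congr 1
  abel

theorem fredholmIndex_add (h : IsParametrix S T) : fredholmIndex S + fredholmIndex T = 0 :=
  h.fredholmIndex_add_of_norm_mul_lt h.isFredholm (by simp)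

theorem fredholmIndex_eq_of_path {S T : unitInterval → E →L[ℂ] E}
    (h : ∀ t, IsParametrix (S t) (T t)) (hT : Continuous T) :
    fredholmIndex (T 0) = fredholmIndex (T 1) := by
  have hloc : IsLocallyConstant fun t => fredholmIndex (T t) := by
    refine (IsLocallyConstant.iff_eventually_eq _).2 fun t => ?_
    have hcont : Continuous fun s => ‖S t * (T s - T t)‖ := by fun_prop
    filter_upwards [hcont.continuousAt.eventually_lt continuousAt_const
      (by simp : ‖S t * (T t - T t)‖ < 1)] with s hs
    have hs' := (h t).fredholmIndex_add_of_norm_mul_lt (h s).isFredholm hs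
    exact add_left_cancel (hs'.trans (h t).fredholmIndex_add.symm)
  exact hloc.apply_eq_of_preconnectedSpace 0 1

end IsParametrix

theorem IsFredholm.isClosed_range (hT : IsFredholm T) :
    IsClosed (LinearMap.range (T : E →ₗ[ℂ] E) : Set E) := by
  obtain ⟨_, _⟩ := hT
  have hcompl : IsCompl (LinearMap.ker (T : E →ₗ[ℂ] E)) (LinearMap.ker (T : E →ₗ[ℂ] E))ᗮ :=
    Submodule.isCompl_orthogonal _
  let T₀ := T ∘L (LinearMap.ker (T : E →ₗ[ℂ] E))ᗮ.subtypeL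
  have hrange : LinearMap.range T₀.toLinearMap = LinearMap.range (T : E →ₗ[ℂ] E) := by
    rw [ContinuousLinearMap.toLinearMap_comp, LinearMap.range_comp, Submodule.toLinearMap_subtypeL,
      Submodule.range_subtype, Submodule.map_eq_range_iff]
    exact hcompl.codisjoint.symm
  have hker : LinearMap.ker T₀.toLinearMap = ⊥ := by
    rw [ContinuousLinearMap.toLinearMap_comp, LinearMap.ker_comp, Submodule.toLinearMap_subtypeL,
      ← Submodule.disjoint_iff_comap_eq_bot]
    exact hcompl.disjoint.symm
  obtain ⟨G, hG⟩ := (LinearMap.range (T : E →ₗ[ℂ] E)).exists_isCompl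
  have : FiniteDimensional ℂ G := (Submodule.quotientEquivOfIsCompl _ _ hG).finiteDimensional
  rw [← hrange] at hG ⊢
  exact T₀.closed_complemented_range_of_isCompl_of_ker_eq_bot G hG G.closed_of_finiteDimensional
    hker

theorem IsFredholm.finrank_coker_eq_finrank_ker_star (hT : IsFredholm T) :
    Module.finrank ℂ (E ⧸ LinearMap.range (T : E →ₗ[ℂ] E)) =
      Module.finrank ℂ (LinearMap.ker (star T : E →L[ℂ] E).toLinearMap) := by
  have : CompleteSpace (LinearMap.range (T : E →ₗ[ℂ] E)) := hT.isClosed_range.completeSpace_coe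
  rw [(Submodule.quotientEquivOfIsCompl _ _ (Submodule.isCompl_orthogonal _)).finrank_eq,
    ContinuousLinearMap.orthogonal_range, ContinuousLinearMap.star_eq_adjoint]

end Compact

/-! ### Hilbert–Schmidt operators and traces -/

section Trace

variable {E : Type u} [NormedAddCommGroup E] [InnerProductSpace ℂ E]

theorem hasSum_norm_inner_sq {ι : Type*} (b : HilbertBasis ι ℂ E) (x : E) :
    HasSum (fun i => ‖⟪b i, x⟫_ℂ‖ ^ 2) (‖x‖ ^ 2) := by
  have hterm : ∀ i, ⟪x, b i⟫_ℂ * ⟪b i, x⟫_ℂ = ((‖⟪b i, x⟫_ℂ‖ ^ 2 : ℝ) : ℂ) := fun i => by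
    rw [← inner_conj_symm x (b i), Complex.conj_mul', Complex.ofReal_pow]
  have hself : ⟪x, x⟫_ℂ = ((‖x‖ ^ 2 : ℝ) : ℂ) := by
    rw [inner_self_eq_norm_sq_to_K, Complex.ofReal_pow]
    rfl
  rw [← Complex.hasSum_ofReal]
  simpa only [hterm, hself] using b.hasSum_inner_mul_inner x x

theorem summable_norm_inner_sq_prod {ι κ : Type*} (b : HilbertBasis ι ℂ E)
    (c : HilbertBasis κ ℂ E) {T : E →L[ℂ] E} (h : Summable fun i => ‖T (b i)‖ ^ 2) :
    Summable fun p : ι × κ => ‖⟪c p.2, T (b p.1)⟫_ℂ‖ ^ 2 :=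
  (summable_prod_of_nonneg fun _ => sq_nonneg _).2
    ⟨fun i => (hasSum_norm_inner_sq c (T (b i))).summable,
      by simpa only [(hasSum_norm_inner_sq c _).tsum_eq] using h⟩

theorem HasTrace.add {S T : E →L[ℂ] E} {z w : ℂ} (hS : HasTrace S z) (hT : HasTrace T w) :
    HasTrace (S + T) (z + w) := fun ι b => by
  simpa only [add_apply, inner_add_right] using (hS ι b).add (hT ι b)

theorem HasTrace.neg {T : E →L[ℂ] E} {z : ℂ} (hT : HasTrace T z) : HasTrace (-T) (-z) :=
  fun ι b => by simpa only [neg_apply, inner_neg_right] using (hT ι b).neg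

theorem hasTrace_starProjection (V : Submodule ℂ E) [FiniteDimensional ℂ V] :
    HasTrace V.starProjection (Module.finrank ℂ V : ℂ) := fun ι b => by
  let e := stdOrthonormalBasis ℂ V
  have hterm : ∀ i, ⟪b i, V.starProjection (b i)⟫_ℂ =
      ∑ j, ⟪(e j : E), b i⟫_ℂ * ⟪b i, (e j : E)⟫_ℂ := fun i => by
    simp only [e.starProjection_eq_sum_rankOne, sum_apply, InnerProductSpace.rankOne_apply,
      inner_sum, inner_smul_right]
  have hunit : ∀ j, ⟪(e j : E), (e j : E)⟫_ℂ = 1 := fun j => by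
    rw [← Submodule.coe_inner, inner_self_eq_norm_sq_to_K, e.norm_eq_one]
    simp
  simp only [hterm]
  simpa only [hunit, Finset.sum_const, Finset.card_univ, Fintype.card_fin, nsmul_eq_mul,
    mul_one] using hasSum_sum fun j (_ : j ∈ Finset.univ) =>
    b.hasSum_inner_mul_inner (e j : E) (e j)

variable {S T : E →L[ℂ] E}

/-- `T` is a Hilbert–Schmidt operator: `∑ ‖T e_i‖² < ∞` for an orthonormal basis `(e_i)`. -/
def IsHilbertSchmidt (T : E →L[ℂ] E) : Prop :=
  ∃ (ι : Type u) (b : HilbertBasis ι ℂ E), Summable fun i => ‖T (b i)‖ ^ 2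

theorem IsHilbertSchmidt.mul_left (hT : IsHilbertSchmidt T) (S : E →L[ℂ] E) :
    IsHilbertSchmidt (S * T) := by
  obtain ⟨ι, b, hb⟩ := hT
  refine ⟨ι, b, (hb.mul_left (‖S‖ ^ 2)).of_nonneg_of_le (fun _ => sq_nonneg _) fun i => ?_⟩
  rw [← mul_pow]
  exact pow_le_pow_left₀ (norm_nonneg _) (S.le_opNorm _) 2

variable [CompleteSpace E]

theorem HasTrace.unique {z w : ℂ} (hz : HasTrace T z) (hw : HasTrace T w) : z = w := by
  obtain ⟨s, b, -⟩ := exists_hilbertBasis ℂ E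
  exact (hz s b).unique (hw s b)

theorem summable_norm_sq_apply_star {ι κ : Type*} (b : HilbertBasis ι ℂ E)
    (c : HilbertBasis κ ℂ E) (h : Summable fun i => ‖T (b i)‖ ^ 2) :
    Summable fun j => ‖(star T) (c j)‖ ^ 2 := by
  have hswap := (summable_norm_inner_sq_prod b c h).prod_symm.prod
  refine hswap.congr fun j => ?_
  rw [← (hasSum_norm_inner_sq b _).tsum_eq]
  refine tsum_congr fun i => ?_
  rw [ContinuousLinearMap.star_eq_adjoint, ContinuousLinearMap.adjoint_inner_right,
    norm_inner_symm]
  rfl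

namespace IsHilbertSchmidt

protected theorem star (hT : IsHilbertSchmidt T) : IsHilbertSchmidt (star T) := by
  obtain ⟨ι, b, hb⟩ := hT
  exact ⟨ι, b, summable_norm_sq_apply_star b b hb⟩

protected theorem summable {ι : Type*} (hT : IsHilbertSchmidt T) (b : HilbertBasis ι ℂ E) :
    Summable fun i => ‖T (b i)‖ ^ 2 := by
  obtain ⟨κ, c, hc⟩ := hT.star
  simpa only [star_star] using summable_norm_sq_apply_star c b hc

theorem mul_right (hS : IsHilbertSchmidt S) (T : E →L[ℂ] E) : IsHilbertSchmidt (S * T) := by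
  simpa only [star_mul, star_star] using (hS.star.mul_left (Star.star T)).star

theorem exists_hasSum_mul {ι κ : Type*} (hS : IsHilbertSchmidt S) (hT : IsHilbertSchmidt T)
    (b : HilbertBasis ι ℂ E) (c : HilbertBasis κ ℂ E) :
    ∃ z, HasSum (fun i => ⟪b i, (S * T) (b i)⟫_ℂ) z ∧
      HasSum (fun j => ⟪c j, (T * S) (c j)⟫_ℂ) z := by
  have hexpand : ∀ i, HasSum (fun j => ⟪b i, S (c j)⟫_ℂ * ⟪c j, T (b i)⟫_ℂ)
      ⟪b i, (S * T) (b i)⟫_ℂ := fun i => by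
    simpa only [ContinuousLinearMap.star_eq_adjoint, ContinuousLinearMap.adjoint_inner_left,
      mul_apply_eq_comp] using c.hasSum_inner_mul_inner ((Star.star S) (b i)) (T (b i))
  have hexpand' : ∀ j, HasSum (fun i => ⟪b i, S (c j)⟫_ℂ * ⟪c j, T (b i)⟫_ℂ)
      ⟪c j, (T * S) (c j)⟫_ℂ := fun j => by
    simpa only [ContinuousLinearMap.star_eq_adjoint, ContinuousLinearMap.adjoint_inner_left,
      mul_apply_eq_comp, mul_comm] using
      b.hasSum_inner_mul_inner ((Star.star T) (c j)) (S (c j))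
  have hsummable : Summable fun p : ι × κ => ⟪b p.1, S (c p.2)⟫_ℂ * ⟪c p.2, T (b p.1)⟫_ℂ := by
    refine .of_norm_bounded (((summable_norm_inner_sq_prod c b (hS.summable c)).prod_symm.add
      (summable_norm_inner_sq_prod b c (hT.summable b)))) fun p => ?_
    rw [norm_mul]
    exact (le_mul_of_one_le_left (by positivity) one_le_two).trans
      ((mul_assoc _ _ _).symm.trans_le (two_mul_le_add_sq _ _))
  exact ⟨_, hsummable.hasSum.prod_fiberwise hexpand,
    ((Equiv.prodComm κ ι).hasSum_iff.2 hsummable.hasSum).prod_fiberwise hexpand'⟩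

theorem exists_hasTrace_mul_comm (hS : IsHilbertSchmidt S) (hT : IsHilbertSchmidt T) :
    ∃ z, HasTrace (S * T) z ∧ HasTrace (T * S) z := by
  obtain ⟨κ, c, -⟩ := id hS
  obtain ⟨z, hST, hTS⟩ := hS.exists_hasSum_mul hT c c
  refine ⟨z, fun ι b => ?_, fun ι b => ?_⟩
  · obtain ⟨w, hw, hw'⟩ := hS.exists_hasSum_mul hT b c
    rwa [hTS.unique hw']
  · obtain ⟨w, hw, hw'⟩ := hS.exists_hasSum_mul hT c b
    rwa [hST.unique hw]

theorem exists_hasTrace_mul_mul_comm (hS : IsHilbertSchmidt S) (hT : IsHilbertSchmidt T)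
    (R : E →L[ℂ] E) : ∃ z, HasTrace (R * (S * T)) z ∧ HasTrace (S * T * R) z := by
  obtain ⟨z, hRST, hTRS⟩ := (hS.mul_left R).exists_hasTrace_mul_comm hT
  obtain ⟨w, hSTR, hTRS'⟩ := hS.exists_hasTrace_mul_comm (hT.mul_right R)
  rw [mul_assoc] at hRST hTRS'
  rw [← mul_assoc] at hSTR
  exact ⟨z, hRST, hTRS.unique hTRS' ▸ hSTR⟩

end IsHilbertSchmidt

theorem norm_star_apply_sq_le {ι : Type*} (b : HilbertBasis ι ℂ E)
    (h : Summable fun i => ‖T (b i)‖ ^ 2) (x : E) :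
    ‖(star T) x‖ ^ 2 ≤ (∑' i, ‖T (b i)‖ ^ 2) * ‖x‖ ^ 2 := by
  have hsum := hasSum_norm_inner_sq b ((star T) x)
  rw [← tsum_mul_right, ← hsum.tsum_eq]
  refine hsum.summable.tsum_le_tsum (fun i => ?_) (h.mul_right _)
  rw [ContinuousLinearMap.star_eq_adjoint, ContinuousLinearMap.adjoint_inner_right, ← mul_pow]
  exact pow_le_pow_left₀ (norm_nonneg _) (norm_inner_le_norm _ _) 2

theorem norm_sq_le_tsum {ι : Type*} (b : HilbertBasis ι ℂ E)
    (h : Summable fun i => ‖T (b i)‖ ^ 2) : ‖T‖ ^ 2 ≤ ∑' i, ‖T (b i)‖ ^ 2 := by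
  have hnonneg : 0 ≤ ∑' i, ‖T (b i)‖ ^ 2 := tsum_nonneg fun i => sq_nonneg _
  rw [← norm_star, ← Real.sq_sqrt hnonneg]
  refine pow_le_pow_left₀ (norm_nonneg _)
    (ContinuousLinearMap.opNorm_le_bound _ (Real.sqrt_nonneg _) fun x => ?_) 2
  refine le_of_sq_le_sq ?_ (by positivity)
  rw [mul_pow, Real.sq_sqrt hnonneg]
  exact norm_star_apply_sq_le b h x

theorem IsHilbertSchmidt.isCompactOperator (hT : IsHilbertSchmidt T) : IsCompactOperator T := by
  obtain ⟨ι, b, hb⟩ := hT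
  have hclosed : IsClosed {T : E →L[ℂ] E | IsCompactOperator T} :=
    isClosed_setOfPred_isCompactOperator
  refine hclosed.closure_subset (Metric.mem_closure_iff.2 fun ε hε => ?_)
  obtain ⟨F, hF⟩ := ((tendsto_tsum_compl_atTop_zero fun i => ‖T (b i)‖ ^ 2).eventually_lt_const
    (pow_pos hε 2)).exists
  let V := Submodule.span ℂ (b '' F)
  have : FiniteDimensional ℂ V := .span_of_finite ℂ (F.finite_toSet.image b)
  have htail : (fun i => ‖(T - T * V.starProjection) (b i)‖ ^ 2) =
      Set.indicator {i | i ∉ F} fun i => ‖T (b i)‖ ^ 2 := funext fun i => by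
    rw [sub_apply, mul_apply_eq_comp]
    by_cases hi : i ∈ F
    · have hmem : b i ∈ V := Submodule.subset_span ⟨i, hi, rfl⟩
      simp [hi, Submodule.starProjection_eq_self_iff.2 hmem]
    · have hortho : V ≤ (ℂ ∙ b i)ᗮ := Submodule.span_le.2 fun _ ⟨j, hj, hji⟩ =>
        Submodule.mem_orthogonal_singleton_iff_inner_right.2
          (hji ▸ b.orthonormal.2 fun hij => hi (hij ▸ hj))
      have hmem : b i ∈ Vᗮ := Submodule.le_orthogonal_iff_le_orthogonal.1 hortho
        (Submodule.mem_span_singleton_self _)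
      simp [hi, (Submodule.starProjection_apply_eq_zero_iff V).2 hmem]
  refine ⟨T * V.starProjection, (isCompactOperator_starProjection V).clm_comp T, ?_⟩
  rw [dist_eq_norm]
  refine lt_of_pow_lt_pow_left₀ 2 hε.le ((norm_sq_le_tsum b ?_).trans_lt ?_)
  · rw [htail]
    exact hb.indicator _
  · rw [htail, ← tsum_subtype]
    exact hF

theorem inner_star_mul_self_apply (T : E →L[ℂ] E) (x : E) :
    ⟪x, (star T * T) x⟫_ℂ = ((‖T x‖ ^ 2 : ℝ) : ℂ) := by
  rw [mul_apply_eq_comp, ContinuousLinearMap.star_eq_adjoint,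
    ContinuousLinearMap.adjoint_inner_right, inner_self_eq_norm_sq_to_K, Complex.ofReal_pow]
  rfl

theorem IsTraceClass.isHilbertSchmidt (hT : IsTraceClass T) (hS : star S * S = CFC.abs T) :
    IsHilbertSchmidt S := by
  obtain ⟨ι, b, hb⟩ := hT
  refine ⟨ι, b, Complex.summable_ofReal.1 ?_⟩
  simpa only [← hS, inner_star_mul_self_apply] using hb

theorem IsTraceClass.exists_isHilbertSchmidt_mul (hT : IsTraceClass T) (hself : IsSelfAdjoint T) :
    ∃ R S : E →L[ℂ] E, IsHilbertSchmidt R ∧ IsHilbertSchmidt S ∧ T = R * S := by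
  let f : ℝ → ℝ := fun x => √|x|
  let g : ℝ → ℝ := fun x => √x⁺ - √x⁻
  have hf : Continuous f := by fun_prop
  have hg : Continuous g :=
    (Real.continuous_sqrt.comp continuous_posPart).sub
      (Real.continuous_sqrt.comp continuous_negPart)
  have hff : ∀ x, f x * f x = |x| := fun x => Real.mul_self_sqrt (abs_nonneg x)
  have hgg : ∀ x, g x * g x = |x| := fun x => by
    rcases le_total 0 x with hx | hx
    · simp [g, posPart_of_nonneg hx, negPart_of_nonneg hx, abs_of_nonneg hx, Real.mul_self_sqrt hx]
    · simp [g, posPart_of_nonpos hx, negPart_of_nonpos hx, abs_of_nonpos hx,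
        Real.mul_self_sqrt (neg_nonneg.2 hx)]
  have hfg : ∀ x, f x * g x = x := fun x => by
    rcases le_total 0 x with hx | hx
    · simp [f, g, posPart_of_nonneg hx, negPart_of_nonneg hx, abs_of_nonneg hx,
        Real.mul_self_sqrt hx]
    · simp [f, g, posPart_of_nonpos hx, negPart_of_nonpos hx, abs_of_nonpos hx,
        Real.mul_self_sqrt (neg_nonneg.2 hx)]
  have hsq : ∀ h : ℝ → ℝ, Continuous h → (∀ x, h x * h x = |x|) → IsHilbertSchmidt (cfc h T) :=
    fun h hh hsq => hT.isHilbertSchmidt <| by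
      rw [(cfc_predicate h T : IsSelfAdjoint _).star_eq, CFC.abs_eq_cfc_norm T hself,
        ← cfc_mul h h T hh.continuousOn hh.continuousOn]
      exact cfc_congr fun x _ => hsq x
  refine ⟨cfc f T, cfc g T, hsq f hf hff, hsq g hg hgg, ?_⟩
  rw [← cfc_mul f g T hf.continuousOn hg.continuousOn]
  simp only [hfg]
  exact (cfc_id' ℝ T).symm

theorem IsTraceClass.isCompactOperator (hT : IsTraceClass T) (hself : IsSelfAdjoint T) :
    IsCompactOperator T := by
  obtain ⟨R, S, hR, -, rfl⟩ := hT.exists_isHilbertSchmidt_mul hself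
  exact hR.isCompactOperator.comp_clm S

end Trace

/-! ### Anticommuting pairs -/

section AnticommutingPair

variable {E : Type u} [NormedAddCommGroup E] [InnerProductSpace ℂ E] [CompleteSpace E]

theorem mul_starProjection_ker (B : E →L[ℂ] E) :
    B * (LinearMap.ker (B : E →ₗ[ℂ] E)).starProjection = 0 :=
  ContinuousLinearMap.ext fun x =>
    Submodule.starProjection_apply_mem (LinearMap.ker (B : E →ₗ[ℂ] E)) x

theorem starProjection_ker_mul {B : E →L[ℂ] E} (hB : IsSelfAdjoint B) :
    (LinearMap.ker (B : E →ₗ[ℂ] E)).starProjection * B = 0 := by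
  have hstar := congrArg star (mul_starProjection_ker B)
  rwa [star_mul, hB.star_eq, (isSelfAdjoint_starProjection _).star_eq, star_zero] at hstar

theorem apply_apply_eq_zero_iff {B : E →L[ℂ] E} (hB : IsSelfAdjoint B) {x : E} :
    B (B x) = 0 ↔ B x = 0 := by
  refine ⟨fun hx => ?_, fun hx => by rw [hx, map_zero]⟩
  have hnorm := inner_star_mul_self_apply B x
  rwa [hB.star_eq, mul_apply_eq_comp, hx, inner_zero_right, eq_comm, Complex.ofReal_eq_zero,
    sq_eq_zero_iff, norm_eq_zero] at hnorm

/-- Two anticommuting self-adjoint operators whose squares add up to the identity. The example to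
keep in mind is `A = Q - P`, `B = 1 - P - Q` for projections `P` and `Q`. -/
structure IsAnticommutingPair (A B : E →L[ℂ] E) : Prop where
  isSelfAdjoint_left : IsSelfAdjoint A
  isSelfAdjoint_right : IsSelfAdjoint B
  anticommute : B * A = -(A * B)
  sq_add_sq : A * A + B * B = 1

theorem isAnticommutingPair_sub {P Q : E →L[ℂ] E} (hP : IsStarProjection P)
    (hQ : IsStarProjection Q) : IsAnticommutingPair (Q - P) (1 - P - Q) where
  isSelfAdjoint_left := hQ.isSelfAdjoint.sub hP.isSelfAdjoint
  isSelfAdjoint_right := (hP.one_sub.isSelfAdjoint).sub hQ.isSelfAdjoint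
  anticommute := by
    simp only [mul_sub, sub_mul, one_mul, mul_one, hP.isIdempotentElem.eq, hQ.isIdempotentElem.eq]
    abel
  sq_add_sq := by
    simp only [mul_sub, sub_mul, one_mul, mul_one, hP.isIdempotentElem.eq, hQ.isIdempotentElem.eq]
    abel

namespace IsAnticommutingPair

variable {A B : E →L[ℂ] E}

protected theorem neg_left (h : IsAnticommutingPair A B) : IsAnticommutingPair (-A) B where
  isSelfAdjoint_left := h.isSelfAdjoint_left.neg
  isSelfAdjoint_right := h.isSelfAdjoint_right
  anticommute := by rw [mul_neg, h.anticommute, neg_mul]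
  sq_add_sq := by rw [neg_mul_neg, h.sq_add_sq]

theorem apply_eq_zero_iff (h : IsAnticommutingPair A B) {x : E} : B x = 0 ↔ A (A x) = x := by
  have hsum : A (A x) + B (B x) = x := DFunLike.congr_fun h.sq_add_sq x
  rw [← apply_apply_eq_zero_iff h.isSelfAdjoint_right, ← add_eq_left (a := A (A x)), hsum, eq_comm]

theorem mem_ker_of_mem_eigenspace (h : IsAnticommutingPair A B) {x : E}
    (hx : x ∈ Module.End.eigenspace (A : E →ₗ[ℂ] E) 1) : x ∈ LinearMap.ker (B : E →ₗ[ℂ] E) := by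
  rw [Module.End.mem_eigenspace_iff, one_smul, ContinuousLinearMap.coe_coe] at hx
  exact h.apply_eq_zero_iff.2 (by rw [hx, hx])

theorem finiteDimensional_ker (h : IsAnticommutingPair A B) (hA : IsCompactOperator A) :
    FiniteDimensional ℂ (LinearMap.ker (B : E →ₗ[ℂ] E)) := by
  have hBB : 1 + -(A * A) + 0 = B * B := by rw [← h.sq_add_sq]; abel
  have hfred : IsFredholm (B * B) := hBB ▸ isFredholm_one_add_add (hA.comp_clm A).neg (by simp)
  have : FiniteDimensional ℂ (LinearMap.ker ((B : E →ₗ[ℂ] E) ∘ₗ (B : E →ₗ[ℂ] E))) := hfred.1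
  exact Submodule.finiteDimensional_of_le
    (LinearMap.ker_le_ker_comp (B : E →ₗ[ℂ] E) (B : E →ₗ[ℂ] E))

theorem finiteDimensional_eigenspace (h : IsAnticommutingPair A B) (hA : IsCompactOperator A) :
    FiniteDimensional ℂ (Module.End.eigenspace (A : E →ₗ[ℂ] E) 1) :=
  have := h.finiteDimensional_ker hA
  Submodule.finiteDimensional_of_le fun _ => h.mem_ker_of_mem_eigenspace

theorem isUnit_sq_add_starProjection_ker (h : IsAnticommutingPair A B)
    (hA : IsCompactOperator A) :
    IsUnit (B * B + (LinearMap.ker (B : E →ₗ[ℂ] E)).starProjection) := by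
  have := h.finiteDimensional_ker hA
  set p := (LinearMap.ker (B : E →ₗ[ℂ] E)).starProjection
  have hpB : p * B = 0 := starProjection_ker_mul h.isSelfAdjoint_right
  have hpp : p * p = p := (LinearMap.ker (B : E →ₗ[ℂ] E)).isIdempotentElem_starProjection
  have hcompact : IsCompactOperator (A * A - p : E →L[ℂ] E) :=
    (hA.comp_clm A).sub (isCompactOperator_starProjection _)
  have hsum : B * B + p = 1 - (A * A - p) := by rw [← h.sq_add_sq]; abel
  rcases hcompact.hasEigenvalue_or_mem_resolventSet one_ne_zero with heig | hres
  · obtain ⟨x, hxeig⟩ := heig.exists_hasEigenvector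
    have hx := hxeig.apply_eq_smul
    have hsumx : (B * B + p) x = 0 := by
      rw [hsum, sub_apply, sub_eq_zero, eq_comm]
      simpa using hx
    have hpx : p x = 0 := by
      have := congrArg p hsumx
      rwa [← mul_apply_eq_comp, mul_add, ← mul_assoc, hpB, zero_mul, zero_add, hpp,
        map_zero] at this
    have hBBx : B (B x) = 0 := by rwa [add_apply, hpx, add_zero] at hsumx
    have hBx : x ∈ LinearMap.ker (B : E →ₗ[ℂ] E) :=
      (apply_apply_eq_zero_iff h.isSelfAdjoint_right).1 hBBx
    exact absurd (hpx ▸ (Submodule.starProjection_eq_self_iff.2 hBx).symm) hxeig.2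
  · simpa [resolventSet, hsum] using hres

theorem hasTrace_mul_one_sub_starProjection_ker (h : IsAnticommutingPair A B)
    (hA : IsTraceClass A) :
    HasTrace (A * (1 - (LinearMap.ker (B : E →ₗ[ℂ] E)).starProjection)) 0 := by
  obtain ⟨R, hR⟩ := h.isUnit_sq_add_starProjection_ker (hA.isCompactOperator h.isSelfAdjoint_left)
  obtain ⟨S, T, hS, hT, hST⟩ := hA.exists_isHilbertSchmidt_mul h.isSelfAdjoint_left
  set p := (LinearMap.ker (B : E →ₗ[ℂ] E)).starProjection
  have hBp : B * p = 0 := mul_starProjection_ker B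
  have hpB : p * B = 0 := starProjection_ker_mul h.isSelfAdjoint_right
  have hpp : p * p = p := (LinearMap.ker (B : E →ₗ[ℂ] E)).isIdempotentElem_starProjection
  have hRB : Commute (↑R⁻¹ : E →L[ℂ] E) B := by
    refine Commute.units_inv_left ?_
    rw [hR]
    exact ((Commute.refl B).mul_left (Commute.refl B)).add_left (hpB.trans hBp.symm)
  have hRBB : ↑R⁻¹ * (B * B) = 1 - p := by
    rw [Units.inv_mul_eq_iff_eq_mul, hR, mul_sub, mul_one, add_mul, mul_assoc, hBp, mul_zero, hpp]
    abel
  obtain ⟨z, hBA, hAB⟩ := hS.exists_hasTrace_mul_mul_comm (hT.mul_right (↑R⁻¹ * B)) B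
  have hleft : B * (S * (T * (↑R⁻¹ * B))) = -(A * (1 - p)) := by
    rw [← mul_assoc S, ← hST, ← mul_assoc, h.anticommute, neg_mul, mul_assoc A, ← mul_assoc B,
      ← hRB.eq, mul_assoc, hRBB]
  have hright : S * (T * (↑R⁻¹ * B)) * B = A * (1 - p) := by
    rw [← mul_assoc S, ← hST, ← hRBB]
    simp only [mul_assoc]
  rw [hleft] at hBA
  rw [hright] at hAB
  rwa [self_eq_neg.1 (hAB.unique (neg_neg (A * (1 - p)) ▸ hBA.neg))] at hAB

theorem starProjection_eigenspace (h : IsAnticommutingPair A B)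
    [(Module.End.eigenspace (A : E →ₗ[ℂ] E) 1).HasOrthogonalProjection] :
    (Module.End.eigenspace (A : E →ₗ[ℂ] E) 1).starProjection =
      (2⁻¹ : ℂ) • ((1 + A) * (LinearMap.ker (B : E →ₗ[ℂ] E)).starProjection) := by
  ext x
  set y := (LinearMap.ker (B : E →ₗ[ℂ] E)).starProjection x with hy
  have hAy : A (A y) = y :=
    h.apply_eq_zero_iff.1 (Submodule.starProjection_apply_mem (LinearMap.ker (B : E →ₗ[ℂ] E)) x)
  refine Submodule.eq_starProjection_of_mem_of_inner_eq_zero ?_ fun z hz => ?_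
  · rw [Module.End.mem_eigenspace_iff]
    simp [← hy, hAy, add_comm]
  · have hAz : A z = z := by simpa using hz
    have hy_z : ⟪y, z⟫_ℂ = ⟪x, z⟫_ℂ := by
      rw [hy, Submodule.inner_starProjection_left_eq_right,
        Submodule.starProjection_eq_self_iff.2 (h.mem_ker_of_mem_eigenspace hz)]
    have hAy_z : ⟪A y, z⟫_ℂ = ⟪x, z⟫_ℂ := by
      rw [← hy_z, ← hAz]
      simpa [hAz] using
        (ContinuousLinearMap.isSelfAdjoint_iff_isSymmetric.1 h.isSelfAdjoint_left) y z
    rw [smul_apply, mul_apply_eq_comp, ← hy, add_apply, one_apply_eq_self, inner_sub_left,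
      inner_smul_left, inner_add_left, hy_z, hAy_z, map_inv₀, Complex.conj_ofNat]
    ring

theorem hasTrace (h : IsAnticommutingPair A B) (hA : IsTraceClass A) :
    HasTrace A (Module.finrank ℂ (Module.End.eigenspace (A : E →ₗ[ℂ] E) 1) -
      Module.finrank ℂ (Module.End.eigenspace (A : E →ₗ[ℂ] E) (-1)) : ℂ) := by
  have hcompact := hA.isCompactOperator h.isSelfAdjoint_left
  have hneg : Module.End.eigenspace (A : E →ₗ[ℂ] E) (-1) =
      Module.End.eigenspace ((-A : E →L[ℂ] E) : E →ₗ[ℂ] E) 1 := by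
    ext x
    simp [neg_eq_iff_eq_neg]
  have := h.finiteDimensional_eigenspace hcompact
  have := h.neg_left.finiteDimensional_eigenspace hcompact.neg
  have hsplit : A = A * (1 - (LinearMap.ker (B : E →ₗ[ℂ] E)).starProjection) +
      ((Module.End.eigenspace (A : E →ₗ[ℂ] E) 1).starProjection +
        -(Module.End.eigenspace ((-A : E →L[ℂ] E) : E →ₗ[ℂ] E) 1).starProjection) := by
    rw [h.starProjection_eigenspace, h.neg_left.starProjection_eigenspace,
      ← sub_eq_add_neg, ← smul_sub, ← sub_mul, add_sub_add_left_eq_sub, sub_neg_eq_add,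
      ← two_smul ℂ, smul_mul_assoc, inv_smul_smul₀ two_ne_zero, mul_sub, mul_one, sub_add_cancel]
  have htrace := (h.hasTrace_mul_one_sub_starProjection_ker hA).add
    ((hasTrace_starProjection (Module.End.eigenspace (A : E →ₗ[ℂ] E) 1)).add
      (hasTrace_starProjection (Module.End.eigenspace ((-A : E →L[ℂ] E) : E →ₗ[ℂ] E) 1)).neg)
  rwa [← hsplit, zero_add, ← sub_eq_add_neg, ← hneg] at htrace

end IsAnticommutingPair

end AnticommutingPair

/-! ### Compressions of unitaries -/

section Compression

variable {E : Type u} [NormedAddCommGroup E] [InnerProductSpace ℂ E]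
variable {P U : E →L[ℂ] E}

/-- The compression of `U` to the range of the projection `P`, extended by the identity on the
complement. -/
def compression (P U : E →L[ℂ] E) : E →L[ℂ] E := P * U * P + (1 - P)

theorem compression_eq_one_add (hP : IsIdempotentElem P) :
    compression P U = 1 + P * (U - 1) * P := by
  rw [compression, mul_sub, sub_mul, mul_one, hP.eq]
  abel

theorem compression_mul_compression_sub_one {V : E →L[ℂ] E} (hP : IsIdempotentElem P)
    (hUV : U * V = 1) :
    compression P U * compression P V - 1 = P * U * ⁅P, V⁆ * P := by
  have hmul : compression P U * compression P V = P * U * P * V * P + (1 - P) := by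
    calc compression P U * compression P V
        = P * U * (P * P) * V * P + P * U * (P * (1 - P)) + ((1 - P) * P) * V * P +
          (1 - P) * (1 - P) := by simp only [compression]; noncomm_ring
      _ = P * U * P * V * P + (1 - P) := by
        rw [hP.eq, hP.mul_one_sub_self, hP.one_sub_mul_self, hP.one_sub.eq, mul_zero, add_zero,
          zero_mul, zero_mul, add_zero]
  calc compression P U * compression P V - 1 = P * U * P * V * P - P := by rw [hmul]; abel
    _ = P * U * P * V * P - P * (U * V) * (P * P) := by rw [hUV, mul_one, hP.eq, hP.eq]
    _ = P * U * ⁅P, V⁆ * P := by rw [Ring.lie_def]; noncomm_ring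

theorem compression_apply_eq_zero_iff (hP : IsIdempotentElem P) {x : E} :
    compression P U x = 0 ↔ P x = x ∧ P (U x) = 0 := by
  have happ : compression P U x = P (U (P x)) + (x - P x) := rfl
  have hPP : ∀ y, P (P y) = P y := DFunLike.congr_fun hP
  rw [happ]
  refine ⟨fun h => ?_, fun ⟨hPx, hPUx⟩ => by rw [hPx, hPUx, sub_self, add_zero]⟩
  have hPUPx : P (U (P x)) = 0 := by
    simpa only [map_add, map_sub, hPP, sub_self, add_zero, map_zero] using congrArg P h
  rw [hPUPx, zero_add, sub_eq_zero] at h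
  exact ⟨h.symm, by rwa [← h] at hPUPx⟩

variable [CompleteSpace E]

theorem star_compression (hP : IsStarProjection P) :
    star (compression P U) = compression P (star U) := by
  simp only [compression, star_add, star_sub, star_mul, star_one, hP.isSelfAdjoint.star_eq,
    mul_assoc]

theorem isCompactOperator_lie_star (hP : IsSelfAdjoint P)
    (hPU : IsCompactOperator (⁅P, U⁆ : E →L[ℂ] E)) :
    IsCompactOperator (⁅P, star U⁆ : E →L[ℂ] E) := by
  have hstar : ⁅P, star U⁆ = -star ⁅P, U⁆ := by
    simp only [Ring.lie_def, star_sub, star_mul, hP.star_eq, neg_sub]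
  rw [hstar]
  exact (isCompactOperator_star hPU).neg

theorem isParametrix_compression_star (hP : IsStarProjection P) (hU : U ∈ unitary (E →L[ℂ] E))
    (hPU : IsCompactOperator (⁅P, U⁆ : E →L[ℂ] E)) :
    IsParametrix (compression P (star U)) (compression P U) where
  left := by
    rw [compression_mul_compression_sub_one hP.isIdempotentElem (Unitary.star_mul_self_of_mem hU)]
    exact (hPU.clm_comp (P * star U)).comp_clm P
  right := by
    rw [compression_mul_compression_sub_one hP.isIdempotentElem (Unitary.mul_star_self_of_mem hU)]
    exact ((isCompactOperator_lie_star hP.isSelfAdjoint hPU).clm_comp (P * U)).comp_clm P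

theorem mem_eigenspace_sub_iff {Q : E →L[ℂ] E} (hP : IsStarProjection P)
    (hQ : IsStarProjection Q) {x : E} :
    x ∈ Module.End.eigenspace ((Q - P : E →L[ℂ] E) : E →ₗ[ℂ] E) 1 ↔ Q x = x ∧ P x = 0 := by
  have heig : x ∈ Module.End.eigenspace ((Q - P : E →L[ℂ] E) : E →ₗ[ℂ] E) 1 ↔ Q x - P x = x := by
    simp
  refine ⟨fun hx => ?_, fun ⟨hQx, hPx⟩ => heig.2 (by rw [hQx, hPx, sub_zero])⟩
  have hsum : x - P x - Q x = 0 := (isAnticommutingPair_sub hP hQ).mem_ker_of_mem_eigenspace hx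
  have hPx : (2 : ℂ) • P x = 0 := by
    rw [two_smul]
    calc P x + P x = x - (x - P x - Q x) - (Q x - P x) := by abel
      _ = 0 := by rw [heig.1 hx, hsum, sub_zero, sub_self]
  have hPx' := (smul_eq_zero.1 hPx).resolve_left two_ne_zero
  exact ⟨by simpa only [hPx', sub_zero] using heig.1 hx, hPx'⟩

theorem isStarProjection_conj (hP : IsStarProjection P) (hU : U ∈ unitary (E →L[ℂ] E)) :
    IsStarProjection (U * P * star U) where
  isIdempotentElem := by
    calc U * P * star U * (U * P * star U) = U * P * (star U * U) * P * star U := by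
          noncomm_ring
      _ = U * P * star U := by
        rw [Unitary.star_mul_self_of_mem hU, mul_one, mul_assoc U P P, hP.isIdempotentElem.eq]
  isSelfAdjoint := hP.isSelfAdjoint.conjugate U

theorem map_ker_compression (hP : IsStarProjection P) (hU : U ∈ unitary (E →L[ℂ] E)) :
    (LinearMap.ker (compression P U : E →ₗ[ℂ] E)).map (U : E →ₗ[ℂ] E) =
      Module.End.eigenspace ((U * P * star U - P : E →L[ℂ] E) : E →ₗ[ℂ] E) 1 := by
  have hUs : ∀ x, U (star U x) = x := DFunLike.congr_fun (Unitary.mul_star_self_of_mem hU)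
  have hsU : ∀ x, star U (U x) = x := DFunLike.congr_fun (Unitary.star_mul_self_of_mem hU)
  have hker : ∀ y, y ∈ LinearMap.ker (compression P U : E →ₗ[ℂ] E) ↔ P y = y ∧ P (U y) = 0 :=
    fun _ => compression_apply_eq_zero_iff hP.isIdempotentElem
  ext x
  rw [mem_eigenspace_sub_iff hP (isStarProjection_conj hP hU), mul_apply_eq_comp,
    mul_apply_eq_comp]
  constructor
  · rintro ⟨y, hy, rfl⟩
    obtain ⟨hPy, hPUy⟩ := (hker y).1 hy
    exact ⟨by rw [ContinuousLinearMap.coe_coe, hsU, hPy], hPUy⟩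
  · rintro ⟨hQx, hPx⟩
    refine ⟨star U x, (hker _).2 ⟨?_, by rw [hUs, hPx]⟩, hUs x⟩
    rw [← hsU (P (star U x)), hQx]

theorem ker_compression_star (hP : IsStarProjection P) (hU : U ∈ unitary (E →L[ℂ] E)) :
    LinearMap.ker (compression P (star U) : E →ₗ[ℂ] E) =
      Module.End.eigenspace ((U * P * star U - P : E →L[ℂ] E) : E →ₗ[ℂ] E) (-1) := by
  have hsU : ∀ x, star U (U x) = x := DFunLike.congr_fun (Unitary.star_mul_self_of_mem hU)
  have hneg : ∀ x, x ∈ Module.End.eigenspace ((U * P * star U - P : E →L[ℂ] E) : E →ₗ[ℂ] E) (-1) ↔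
      x ∈ Module.End.eigenspace ((P - U * P * star U : E →L[ℂ] E) : E →ₗ[ℂ] E) 1 := fun x => by
    rw [← neg_sub P]
    simp only [Module.End.mem_eigenspace_iff, ContinuousLinearMap.coe_coe, neg_apply, neg_smul,
      one_smul, neg_inj]
  ext x
  rw [hneg, mem_eigenspace_sub_iff (isStarProjection_conj hP hU) hP, LinearMap.mem_ker,
    ContinuousLinearMap.coe_coe, compression_apply_eq_zero_iff hP.isIdempotentElem]
  refine and_congr_right fun _ => ⟨fun h => ?_, fun h => ?_⟩
  · rw [mul_apply_eq_comp, mul_apply_eq_comp, h, map_zero]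
  · rw [← hsU (P (star U x))]
    exact (congrArg (star U : E →L[ℂ] E) h).trans (map_zero _)

theorem hasTrace_mul_lie_star (hP : IsStarProjection P) (hU : U ∈ unitary (E →L[ℂ] E))
    (hT : IsTraceClass (U * ⁅P, star U⁆)) :
    HasTrace (U * ⁅P, star U⁆) (fredholmIndex (compression P U)) := by
  have hQ := isStarProjection_conj hP hU
  have hsub : U * ⁅P, star U⁆ = U * P * star U - P := by
    rw [Ring.lie_def, mul_sub, ← mul_assoc, ← mul_assoc, Unitary.mul_star_self_of_mem hU, one_mul]
  have hPU : IsCompactOperator (⁅P, U⁆ : E →L[ℂ] E) := by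
    have hlie : ⁅P, U⁆ = -((U * P * star U - P) * U) := by
      rw [Ring.lie_def, sub_mul, mul_assoc _ (star U), Unitary.star_mul_self_of_mem hU, mul_one,
        neg_sub]
    rw [hlie]
    rw [hsub] at hT
    exact ((hT.isCompactOperator (hQ.isSelfAdjoint.sub hP.isSelfAdjoint)).comp_clm U).neg
  have hinj : Function.Injective (U : E →ₗ[ℂ] E) := Function.LeftInverse.injective
    (g := (star U : E →L[ℂ] E)) (DFunLike.congr_fun (Unitary.star_mul_self_of_mem hU))
  have hF := (isParametrix_compression_star hP hU hPU).isFredholm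
  rw [hsub] at hT ⊢
  have htrace := (isAnticommutingPair_sub hP hQ).hasTrace hT
  rw [← map_ker_compression hP hU, ← ker_compression_star hP hU, ← star_compression hP,
    ← (Submodule.equivMapOfInjective _ hinj _).finrank_eq,
    ← hF.finrank_coker_eq_finrank_ker_star] at htrace
  simpa only [fredholmIndex, Int.cast_sub, Int.cast_natCast] using htrace

end Compression

/-! ### The spectral measure of an `X`-module -/

open Filter Topology
open scoped CompactlySupported CStarAlgebra

section Projections

variable {E : Type u} [NormedAddCommGroup E] [InnerProductSpace ℂ E]

theorem ext_of_forall_inner_apply {S T : E →L[ℂ] E} (h : ∀ x, ⟪x, S x⟫_ℂ = ⟪x, T x⟫_ℂ) :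
    S = T := by
  refine ContinuousLinearMap.coe_injective ((ext_inner_map _ _).1 fun x => ?_)
  rw [← inner_conj_symm, ← inner_conj_symm _ x]
  exact congrArg _ (h x)

variable [CompleteSpace E]

theorem tendsto_starProjection_iInf {ι : Type*} [Preorder ι]
    (K : ι → Submodule ℂ E) [∀ i, (K i).HasOrthogonalProjection]
    [(⨅ i, K i).HasOrthogonalProjection] (hK : Antitone K) (x : E) :
    Tendsto (fun i => (K i).starProjection x) atTop (𝓝 ((⨅ i, K i).starProjection x)) := by
  have hsup : (⨆ i, (K i)ᗮ).topologicalClosure = (⨅ i, K i)ᗮ := by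
    rw [← Submodule.orthogonal_orthogonal_eq_closure, ← Submodule.iInf_orthogonal]
    simp only [Submodule.orthogonal_orthogonal]
  have hlim := Submodule.starProjection_tendsto_closure_iSup (fun i => (K i)ᗮ)
    (fun i j hij => Submodule.orthogonal_le (hK hij)) x
  simpa only [hsup, Submodule.starProjection_orthogonal', sub_apply, one_apply_eq_self,
    sub_sub_cancel] using hlim.const_sub x

theorem inner_starProjection_apply (K : Submodule ℂ E) [K.HasOrthogonalProjection] (x : E) :
    ⟪x, K.starProjection x⟫_ℂ = (‖K.starProjection x‖ ^ 2 : ℝ) := by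
  rw [← inner_star_mul_self_apply, (isSelfAdjoint_starProjection K).star_eq,
    K.isIdempotentElem_starProjection.eq]

end Projections

section Cutoff

variable {X : Type v} [TopologicalSpace X]

/-- A compactly supported real function as an element of `C₀(X)`. -/
def complexify (f : C_c(X, ℝ)) : C₀(X, ℂ) where
  toFun x := (f x : ℂ)
  continuous_toFun := Complex.continuous_ofReal.comp f.continuous
  zero_at_infty' := (f.hasCompactSupport.comp_left (g := Complex.ofReal)
    Complex.ofReal_zero).is_zero_at_infty

@[simp]
theorem complexify_apply (f : C_c(X, ℝ)) (x : X) : complexify f x = (f x : ℂ) := rfl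

theorem norm_le_iff {f : C₀(X, ℂ)} {C : ℝ} (hC : 0 ≤ C) : ‖f‖ ≤ C ↔ ∀ x, ‖f x‖ ≤ C := by
  rw [← ZeroAtInftyContinuousMap.norm_toBCF_eq_norm]
  exact BoundedContinuousFunction.norm_le hC

variable (X) in
/-- The compactly supported continuous functions `X → [0, 1]`. -/
abbrev Cutoff : Type v := {f : C_c(X, ℝ) // ∀ x, f x ∈ Set.Icc (0 : ℝ) 1}

theorem norm_complexify_le_one (f : Cutoff X) : ‖complexify f.1‖ ≤ 1 :=
  (norm_le_iff zero_le_one).2 fun x => by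
    simpa [abs_of_nonneg (f.2 x).1] using (f.2 x).2

/-- The filter along which a cutoff function supported in `U` increases to the indicator function
of `U`: it is eventually `1` on each compact subset of `U`. -/
def cutoffFilter (U : Set X) : Filter (Cutoff X) :=
  ⨅ (K : Set X) (_ : IsCompact K ∧ K ⊆ U),
    𝓟 {f : Cutoff X | tsupport f.1 ⊆ U ∧ ∀ x ∈ K, f.1 x = 1}

theorem eventually_cutoffFilter {U K : Set X} (hK : IsCompact K) (hKU : K ⊆ U) :
    ∀ᶠ f in cutoffFilter U, tsupport f.1 ⊆ U ∧ ∀ x ∈ K, f.1 x = 1 :=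
  mem_iInf_of_mem K (mem_iInf_of_mem ⟨hK, hKU⟩ (mem_principal_self _))

theorem eventually_cutoffFilter_tsupport_subset (U : Set X) :
    ∀ᶠ f in cutoffFilter U, tsupport f.1 ⊆ U :=
  (eventually_cutoffFilter isCompact_empty (Set.empty_subset U)).mono fun _ h => h.1

theorem cutoffFilter_neBot [R1Space X] [LocallyCompactSpace X] {U : Set X} (hU : IsOpen U) :
    (cutoffFilter U).NeBot := by
  refine (hasBasis_biInf_principal' (fun K hK L hL => ⟨K ∪ L,
    ⟨hK.1.union hL.1, Set.union_subset hK.2 hL.2⟩, ?_, ?_⟩)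
    ⟨∅, isCompact_empty, U.empty_subset⟩).neBot_iff.2 fun {K} hK => ?_
  · exact fun f hf => ⟨hf.1, fun x hx => hf.2 x (Or.inl hx)⟩
  · exact fun f hf => ⟨hf.1, fun x hx => hf.2 x (Or.inr hx)⟩
  · obtain ⟨f, hfK, hfc, hfU, hf⟩ :=
      exists_continuousMap_one_of_isCompact_subset_isOpen hK.1 hU hK.2
    exact ⟨⟨⟨f, hfc⟩, hf⟩, hfU, hfK⟩

theorem tendsto_complexify_mul {U : Set X} {g : C₀(X, ℂ)} (hg : ∀ x ∉ U, g x = 0) :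
    Tendsto (fun f : Cutoff X => complexify f.1 * g) (cutoffFilter U) (𝓝 g) := by
  refine Metric.tendsto_nhds.2 fun ε hε => ?_
  have hcompact : IsCompact {x | ε / 2 ≤ ‖g x‖} := by
    have hsmall : ∀ᶠ x in cocompact X, ‖g x‖ < ε / 2 := by
      have := (zero_at_infty g).norm
      rw [norm_zero] at this
      exact this.eventually_lt_const (half_pos hε)
    obtain ⟨K, hK, hKg⟩ := mem_cocompact.1 hsmall
    exact hK.of_isClosed_subset (isClosed_le continuous_const (map_continuous g).norm)
      fun x (hx : ε / 2 ≤ ‖g x‖) => by_contra fun hxK => hx.not_gt (hKg hxK)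
  have hsub : {x | ε / 2 ≤ ‖g x‖} ⊆ U := fun x hx => by_contra fun hxU => by
    rw [Set.mem_ofPred_eq, hg x hxU, norm_zero] at hx
    linarith
  filter_upwards [eventually_cutoffFilter hcompact hsub] with f hf
  rw [dist_eq_norm]
  refine lt_of_le_of_lt ((norm_le_iff (half_pos hε).le).2 fun x => ?_) (half_lt_self hε)
  have hfac : (complexify f.1 * g - g) x = ((f.1 x - 1 : ℝ) : ℂ) * g x := by
    simp [sub_mul]
  rw [hfac, norm_mul, Complex.norm_real, Real.norm_eq_abs]
  by_cases hx : ε / 2 ≤ ‖g x‖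
  · rw [hf.2 x hx, sub_self, abs_zero, zero_mul]
    exact (half_pos hε).le
  · have habs : |f.1 x - 1| ≤ 1 := abs_le.2 ⟨by linarith [(f.2 x).1], by linarith [(f.2 x).2]⟩
    exact (mul_le_of_le_one_left (norm_nonneg _) habs).trans (not_le.1 hx).le

end Cutoff

section SpectralMeasure

variable {X : Type v} [MetricSpace X]
variable {H : Type u} [NormedAddCommGroup H] [InnerProductSpace ℂ H] [CompleteSpace H]
variable (ρ : C₀(X, ℂ) →⋆ₙₐ[ℂ] (H →L[ℂ] H))

theorem essentialSubspace_mono {U V : Set X} (h : U ⊆ V) :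
    essentialSubspace ρ U ≤ essentialSubspace ρ V := by
  refine Submodule.topologicalClosure_mono (Submodule.span_mono ?_)
  rintro η ⟨f, hf, ξ, rfl⟩
  exact ⟨f, fun x hx => hf x fun hxU => hx (h hxU), ξ, rfl⟩

theorem apply_mem_essentialSubspace {U : Set X} {f : C₀(X, ℂ)} (hf : ∀ x ∉ U, f x = 0) (ξ : H) :
    ρ f ξ ∈ essentialSubspace ρ U :=
  Submodule.le_topologicalClosure _ (Submodule.subset_span ⟨f, hf, ξ, rfl⟩)

theorem spectralSubspace_mono {V W : Set X} (h : V ⊆ W) :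
    spectralSubspace ρ V ≤ spectralSubspace ρ W :=
  le_iInf fun U => iInf_le_of_le ⟨U.1, U.2.1, h.trans U.2.2⟩ le_rfl

theorem spectralSubspace_of_isOpen {U : Set X} (hU : IsOpen U) :
    spectralSubspace ρ U = essentialSubspace ρ U :=
  le_antisymm (iInf_le_of_le ⟨U, hU, subset_rfl⟩ le_rfl)
    (le_iInf fun V => essentialSubspace_mono ρ V.2.2)

theorem isStarProjection_chi (W : Set X) : IsStarProjection (chi ρ W) :=
  isStarProjection_starProjection

theorem star_chi (W : Set X) : star (chi ρ W) = chi ρ W :=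
  (isStarProjection_chi ρ W).isSelfAdjoint

theorem chi_mul_self (W : Set X) : chi ρ W * chi ρ W = chi ρ W :=
  (isStarProjection_chi ρ W).isIdempotentElem

theorem chi_mul_of_subset {V W : Set X} (h : V ⊆ W) : chi ρ V * chi ρ W = chi ρ V :=
  Submodule.starProjection_comp_starProjection_of_le (spectralSubspace_mono ρ h)

theorem chi_mul_of_superset {V W : Set X} (h : V ⊆ W) : chi ρ W * chi ρ V = chi ρ V := by
  have hstar := congrArg star (chi_mul_of_subset ρ h)
  rwa [star_mul, star_chi, star_chi] at hstar

theorem norm_chi_apply_mono {V W : Set X} (h : V ⊆ W) (ξ : H) : ‖chi ρ V ξ‖ ≤ ‖chi ρ W ξ‖ := by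
  rw [← chi_mul_of_subset ρ h, mul_apply_eq_comp]
  exact Submodule.norm_starProjection_apply_le _ _

theorem chi_univ (hρ : IsNondegenerate ρ) : chi ρ Set.univ = 1 := by
  ext ξ
  refine Submodule.starProjection_eq_self_iff.2 ?_
  rw [spectralSubspace_of_isOpen ρ isOpen_univ, show essentialSubspace ρ Set.univ = ⊤ from hρ]
  exact Submodule.mem_top

instance (W : Set X) : IsDirectedOrder {U : Set X // IsOpen U ∧ W ⊆ U}ᵒᵈ where
  directed U V := ⟨OrderDual.toDual ⟨(OrderDual.ofDual U).1 ∩ (OrderDual.ofDual V).1,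
      (OrderDual.ofDual U).2.1.inter (OrderDual.ofDual V).2.1,
      Set.subset_inter (OrderDual.ofDual U).2.2 (OrderDual.ofDual V).2.2⟩,
    Set.inter_subset_left, Set.inter_subset_right⟩

theorem tendsto_chi_isOpen (W : Set X) (ξ : H) :
    Tendsto (fun U : {U : Set X // IsOpen U ∧ W ⊆ U}ᵒᵈ => chi ρ (OrderDual.ofDual U).1 ξ) atTop
      (𝓝 (chi ρ W ξ)) := by
  let Nhd := {U : Set X // IsOpen U ∧ W ⊆ U}
  have hinf : (⨅ U : Nhdᵒᵈ, spectralSubspace ρ (OrderDual.ofDual U).1) = spectralSubspace ρ W :=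
    iInf_congr fun U => spectralSubspace_of_isOpen ρ (OrderDual.ofDual U).2.1
  have : (⨅ U : Nhdᵒᵈ, spectralSubspace ρ (OrderDual.ofDual U).1).HasOrthogonalProjection := by
    rw [hinf]
    infer_instance
  have hlim := tendsto_starProjection_iInf
    (fun U : Nhdᵒᵈ => spectralSubspace ρ (OrderDual.ofDual U).1)
    (fun U V hUV => spectralSubspace_mono ρ hUV) ξ
  simp only [hinf] at hlim
  exact hlim

theorem apply_mul_chi {U : Set X} (hU : IsOpen U) {f : C₀(X, ℂ)} (hf : ∀ x ∉ U, f x = 0) :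
    ρ f * chi ρ U = ρ f := by
  have hchi : chi ρ U * ρ (star f) = ρ (star f) := by
    ext ξ
    refine Submodule.starProjection_eq_self_iff.2 ?_
    rw [spectralSubspace_of_isOpen ρ hU]
    exact apply_mem_essentialSubspace ρ (fun x hx => by simp [hf x hx]) ξ
  have hstar := congrArg star hchi
  rwa [star_mul, star_chi, ← map_star, star_star] at hstar

theorem tendsto_apply_complexify {U : Set X} {ξ : H} (hξ : ξ ∈ essentialSubspace ρ U) :
    Tendsto (fun f : Cutoff X => ρ (complexify f.1) ξ) (cutoffFilter U) (𝓝 ξ) := by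
  have hequi : Equicontinuous fun (f : Cutoff X) ξ => ρ (complexify f.1) ξ := by
    refine (LipschitzWith.uniformEquicontinuous _ 1 fun f => ?_).equicontinuous
    refine (ρ (complexify f.1)).lipschitz.weaken ?_
    exact (NonUnitalStarAlgHom.norm_apply_le ρ _).trans (norm_complexify_le_one f)
  refine closure_minimal (fun ξ hξ => Set.mem_ofPred.2 ?_)
    (hequi.isClosed_setOfPred_tendsto continuous_id') hξ
  induction hξ using Submodule.span_induction with
  | mem η hη =>
    obtain ⟨g, hg, ζ, rfl⟩ := hη
    have hcont : Continuous fun f : C₀(X, ℂ) => ρ f ζ :=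
      (map_continuous ρ).clm_apply continuous_const
    have := (hcont.tendsto g).comp (tendsto_complexify_mul hg)
    simpa only [Function.comp_def, map_mul, mul_apply_eq_comp] using this
  | zero => simpa only [map_zero] using tendsto_const_nhds
  | add x y _ _ hx hy => simpa only [map_add] using hx.add hy
  | smul a x _ hx => simpa only [map_smul] using hx.const_smul a

theorem inner_apply_complexify_nonneg {f : C_c(X, ℝ)} (hf : 0 ≤ f) (ξ : H) :
    0 ≤ (⟪ξ, ρ (complexify f) ξ⟫_ℂ).re := by
  let g : C_c(X, ℝ) := ⟨⟨fun x => √(f x), f.continuous.sqrt⟩,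
    f.hasCompactSupport.comp_left (g := Real.sqrt) Real.sqrt_zero⟩
  have hg : complexify f = star (complexify g) * complexify g := by
    ext x
    have hsq : √(f x) * √(f x) = f x := Real.mul_self_sqrt (hf x)
    simp [g, ← Complex.ofReal_mul, hsq]
  rw [hg, map_mul, map_star, inner_star_mul_self_apply, Complex.ofReal_re]
  positivity

/-- The positive functional `f ↦ ⟨ξ, f ξ⟩`. -/
def vectorFunctional (ξ : H) : C_c(X, ℝ) →ₚ[ℝ] ℝ :=
  PositiveLinearMap.mk₀
    { toFun := fun f => (⟪ξ, ρ (complexify f) ξ⟫_ℂ).re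
      map_add' := fun f g => by
        have hadd : complexify (f + g) = complexify f + complexify g := by ext x; simp
        rw [hadd, map_add, add_apply, inner_add_right, Complex.add_re]
      map_smul' := fun a f => by
        have hsmul : complexify (a • f) = (a : ℂ) • complexify f := by ext x; simp
        rw [hsmul, map_smul, smul_apply, inner_smul_right, Complex.re_ofReal_mul]
        rfl }
    fun f hf => inner_apply_complexify_nonneg ρ hf ξ

theorem tendsto_vectorFunctional {U : Set X} (hU : IsOpen U) (ξ : H) :
    Tendsto (fun f : Cutoff X => vectorFunctional ρ ξ f.1) (cutoffFilter U)
      (𝓝 (‖chi ρ U ξ‖ ^ 2)) := by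
  have hmem : chi ρ U ξ ∈ essentialSubspace ρ U := by
    rw [← spectralSubspace_of_isOpen ρ hU]
    exact Submodule.starProjection_apply_mem _ _
  have hlim : Tendsto (fun f : Cutoff X => (⟪ξ, ρ (complexify f.1) (chi ρ U ξ)⟫_ℂ).re)
      (cutoffFilter U) (𝓝 (⟪ξ, chi ρ U ξ⟫_ℂ).re) :=
    (Complex.continuous_re.tendsto _).comp (tendsto_const_nhds.inner
      (tendsto_apply_complexify ρ hmem))
  rw [chi, inner_starProjection_apply, Complex.ofReal_re] at hlim
  refine hlim.congr' ?_
  filter_upwards [eventually_cutoffFilter_tsupport_subset U] with f hf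
  have hzero : ∀ x ∉ U, complexify f.1 x = 0 := fun x hx => by
    rw [complexify_apply, image_eq_zero_of_notMem_tsupport fun h => hx (hf h), Complex.ofReal_zero]
  change (⟪ξ, (ρ (complexify f.1) * chi ρ U) ξ⟫_ℂ).re = _
  rw [apply_mul_chi ρ hU hzero]
  rfl

variable [LocallyCompactSpace X] [MeasurableSpace X] [BorelSpace X]

/-- The scalar spectral measure of a vector. -/
def vectorMeasure (ξ : H) : MeasureTheory.Measure X :=
  RealRMK.rieszMeasure (vectorFunctional ρ ξ)

instance (ξ : H) : (vectorMeasure ρ ξ).Regular := RealRMK.regular_rieszMeasure _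

theorem vectorMeasure_of_isOpen (ξ : H) {U : Set X} (hU : IsOpen U) :
    vectorMeasure ρ ξ U = ENNReal.ofReal (‖chi ρ U ξ‖ ^ 2) := by
  have := cutoffFilter_neBot hU
  have hlim := ENNReal.tendsto_ofReal (tendsto_vectorFunctional ρ hU ξ)
  apply le_antisymm
  · rw [hU.measure_eq_iSup_isCompact]
    refine iSup_le fun K => iSup_le fun hKU => iSup_le fun hK => ge_of_tendsto hlim ?_
    filter_upwards [eventually_cutoffFilter hK hKU] with f hf
    exact RealRMK.rieszMeasure_le_of_eq_one _ (fun x => (f.2 x).1) hK hf.2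
  · refine le_of_tendsto hlim ?_
    filter_upwards [eventually_cutoffFilter_tsupport_subset U] with f hf
    exact RealRMK.le_rieszMeasure_tsupport_subset _ f.2 hf

theorem vectorMeasure_apply (ξ : H) (W : Set X) :
    vectorMeasure ρ ξ W = ENNReal.ofReal (‖chi ρ W ξ‖ ^ 2) := by
  apply le_antisymm
  · have : Nonempty {U : Set X // IsOpen U ∧ W ⊆ U} := ⟨⟨Set.univ, isOpen_univ, W.subset_univ⟩⟩
    refine ge_of_tendsto' (ENNReal.tendsto_ofReal ((tendsto_chi_isOpen ρ W ξ).norm.pow 2))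
      fun U => ?_
    rw [← vectorMeasure_of_isOpen ρ ξ (OrderDual.ofDual U).2.1]
    exact MeasureTheory.measure_mono (OrderDual.ofDual U).2.2
  · rw [W.measure_eq_iInf_isOpen]
    refine le_iInf fun U => le_iInf fun hWU => le_iInf fun hU => ?_
    rw [vectorMeasure_of_isOpen ρ ξ hU]
    gcongr
    exact norm_chi_apply_mono ρ hWU ξ

theorem chi_union {V W : Set X} (hVW : Disjoint V W) (hW : MeasurableSet W) :
    chi ρ (V ∪ W) = chi ρ V + chi ρ W := by
  refine ext_of_forall_inner_apply fun ξ => ?_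
  have hmeasure := MeasureTheory.measure_union (μ := vectorMeasure ρ ξ) hVW hW
  rw [vectorMeasure_apply, vectorMeasure_apply, vectorMeasure_apply,
    ← ENNReal.ofReal_add (sq_nonneg _) (sq_nonneg _),
    ENNReal.ofReal_eq_ofReal_iff (sq_nonneg _) (by positivity)] at hmeasure
  rw [add_apply, inner_add_right]
  simp only [chi, inner_starProjection_apply] at hmeasure ⊢
  rw [hmeasure, Complex.ofReal_add]

theorem chi_compl (hρ : IsNondegenerate ρ) {W : Set X} (hW : MeasurableSet W) :
    chi ρ Wᶜ = 1 - chi ρ W := by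
  rw [eq_sub_iff_add_eq, ← chi_union ρ disjoint_compl_left hW, Set.compl_union_self,
    chi_univ ρ hρ]

theorem chi_mul_of_disjoint (hρ : IsNondegenerate ρ) {V W : Set X} (hW : MeasurableSet W)
    (hVW : Disjoint V W) : chi ρ V * chi ρ W = 0 := by
  have hcompl := chi_mul_of_subset ρ hVW.subset_compl_right
  rwa [chi_compl ρ hρ hW, mul_sub, mul_one, sub_eq_self] at hcompl

theorem chi_inter (hρ : IsNondegenerate ρ) {V W : Set X} (hV : MeasurableSet V)
    (hW : MeasurableSet W) : chi ρ (V ∩ W) = chi ρ V * chi ρ W := by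
  have hunion := chi_union ρ (V := V ∩ W) (W := V \ W)
    (Set.disjoint_sdiff_right.mono_left Set.inter_subset_right) (hV.diff hW)
  rw [Set.inter_union_sdiff] at hunion
  rw [hunion, add_mul, chi_mul_of_subset ρ Set.inter_subset_right,
    chi_mul_of_disjoint ρ hρ hW Set.disjoint_sdiff_left, add_zero]

end SpectralMeasure

/-! ### Coarse boundaries -/

section Thickening

variable {X : Type v} [MetricSpace X]

theorem cthickening_subset_neighborhood {r s : ℝ} (hr : 0 ≤ r) (h : r < s) (Y : Set X) :
    Metric.cthickening r Y ⊆ neighborhood s Y := fun x hx => by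
  obtain ⟨y, hy, hxy⟩ := Metric.mem_thickening_iff.1
    (Metric.cthickening_subset_thickening' (hr.trans_lt h) h Y hx)
  exact ⟨y, hy, hxy.le⟩

theorem mem_coarseBoundary {Y Z : Set X} {r s : ℝ} (hr : 0 < r) (hs : 0 < s)
    (hZ : Z ⊆ neighborhood r Y) (hZ' : Z ⊆ neighborhood s Yᶜ) : Z ∈ coarseBoundary Y :=
  ⟨Z, ⟨r, hr, hZ⟩, Z, ⟨s, hs, hZ'⟩, Set.inter_self Z⟩

theorem cthickening_subset_neighborhood_add {δ r : ℝ} (hδ : 0 ≤ δ) {Y Z : Set X}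
    (h : Z ⊆ neighborhood r Y) : Metric.cthickening δ Z ⊆ neighborhood (r + (δ + 1)) Y :=
  fun x hx => by
    obtain ⟨z, hz, hxz⟩ := cthickening_subset_neighborhood hδ (lt_add_one δ) Z hx
    obtain ⟨y, hy, hzy⟩ := h hz
    exact ⟨y, hy, (dist_triangle x z y).trans (by linarith)⟩

theorem cthickening_mem_coarseBoundary {δ : ℝ} (hδ : 0 ≤ δ) {Y Z : Set X}
    (hZ : Z ∈ coarseBoundary Y) : Metric.cthickening δ Z ∈ coarseBoundary Y := by
  obtain ⟨A, ⟨r, hr, hA⟩, B, ⟨s, hs, hB⟩, rfl⟩ := hZ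
  exact mem_coarseBoundary (by positivity) (by positivity)
    (cthickening_subset_neighborhood_add hδ (Set.inter_subset_left.trans hA))
    (cthickening_subset_neighborhood_add hδ (Set.inter_subset_right.trans hB))

theorem cthickening_inter_compl_mem_coarseBoundary {r : ℝ} (hr : 0 ≤ r) (W : Set X) :
    Metric.cthickening r W ∩ Wᶜ ∈ coarseBoundary W :=
  mem_coarseBoundary (by positivity) one_pos
    (Set.inter_subset_left.trans (cthickening_subset_neighborhood hr (lt_add_one r) W))
    fun x hx => ⟨x, hx.2, by simp⟩

end Thickening

/-! ### Operators commuting with a projection modulo compact operators -/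

section EssentialCommutant

variable {E : Type u} [NormedAddCommGroup E] [InnerProductSpace ℂ E] [CompleteSpace E]

/-- The essential commutant of `P`: the operators that commute with `P` modulo compact operators. -/
def essentialCommutant (P : E →L[ℂ] E) (hP : IsSelfAdjoint P) :
    NonUnitalStarSubalgebra ℂ (E →L[ℂ] E) where
  carrier := {T | IsCompactOperator (⁅P, T⁆ : E →L[ℂ] E)}
  zero_mem' := by
    rw [Set.mem_ofPred_eq, Ring.lie_def, mul_zero, zero_mul, sub_zero]
    exact isCompactOperator_zero
  add_mem' {S T} hS hT := by
    have hadd : ⁅P, S + T⁆ = ⁅P, S⁆ + ⁅P, T⁆ := by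
      simp only [Ring.lie_def]
      noncomm_ring
    rw [Set.mem_ofPred_eq, hadd]
    exact IsCompactOperator.add hS hT
  mul_mem' {S T} hS hT := by
    have hleibniz : ⁅P, S * T⁆ = ⁅P, S⁆ * T + S * ⁅P, T⁆ := by
      simp only [Ring.lie_def]
      noncomm_ring
    rw [Set.mem_ofPred_eq, hleibniz]
    exact (hS.comp_clm T).add (hT.clm_comp S)
  smul_mem' c T hT := by
    have hsmul : ⁅P, c • T⁆ = c • ⁅P, T⁆ := by
      simp only [Ring.lie_def, mul_smul_comm, smul_mul_assoc, smul_sub]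
    rw [Set.mem_ofPred_eq, hsmul]
    exact IsCompactOperator.smul hT c
  star_mem' hT := isCompactOperator_lie_star hP hT

theorem mem_essentialCommutant {P T : E →L[ℂ] E} {hP : IsSelfAdjoint P} :
    T ∈ essentialCommutant P hP ↔ IsCompactOperator (⁅P, T⁆ : E →L[ℂ] E) :=
  Iff.rfl

theorem isClosed_essentialCommutant {P : E →L[ℂ] E} (hP : IsSelfAdjoint P) :
    IsClosed (essentialCommutant P hP : Set (E →L[ℂ] E)) := by
  have hcont : Continuous fun T : E →L[ℂ] E => ⁅P, T⁆ := by
    simp only [Ring.lie_def]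
    fun_prop
  exact isClosed_setOfPred_isCompactOperator.preimage hcont

theorem mem_essentialCommutant_of_corners {P T : E →L[ℂ] E} (hP : IsSelfAdjoint P)
    (hT : IsCompactOperator ((1 - P) * T * P : E →L[ℂ] E))
    (hT' : IsCompactOperator ((1 - P) * star T * P : E →L[ℂ] E)) :
    T ∈ essentialCommutant P hP := by
  have hcorner : star ((1 - P) * star T * P) = P * T * (1 - P) := by
    rw [star_mul, star_mul, star_star, star_sub, star_one, hP.star_eq, mul_assoc]
  have hlie : ⁅P, T⁆ = P * T * (1 - P) - (1 - P) * T * P := by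
    rw [Ring.lie_def]
    noncomm_ring
  have hcompact := isCompactOperator_star hT'
  rw [hcorner] at hcompact
  rw [mem_essentialCommutant, hlie]
  exact hcompact.sub hT

end EssentialCommutant

/-! ### The localized Roe algebra -/

section RoeAlgebra

variable {H : Type u} [NormedAddCommGroup H] [InnerProductSpace ℂ H] [CompleteSpace H]
variable {X : Type v} [MetricSpace X] (ρ : C₀(X, ℂ) →⋆ₙₐ[ℂ] (H →L[ℂ] H))

/-- `S` maps the vectors supported in `V` to vectors supported in the closed `r`-neighbourhood
of `V`. -/
def IsControlled [MeasurableSpace X] (r : ℝ) (S : H →L[ℂ] H) : Prop :=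
  ∀ V : Set X, MeasurableSet V →
    chi ρ (Metric.cthickening r V) * (S * chi ρ V) = S * chi ρ V

variable {ρ}

theorem chi_mul_eq_zero {U : Set X} (hU : IsOpen U) {T : H →L[ℂ] H}
    (h : ∀ f : C₀(X, ℂ), (∀ x ∉ U, f x = 0) → ρ f * T = 0) : chi ρ U * T = 0 := by
  ext ξ
  refine (Submodule.starProjection_apply_eq_zero_iff _).2 ?_
  rw [spectralSubspace_of_isOpen ρ hU, essentialSubspace, Submodule.orthogonal_closure,
    Submodule.mem_orthogonal]
  have hle : Submodule.span ℂ {η | ∃ f : C₀(X, ℂ), (∀ x ∉ U, f x = 0) ∧ ∃ ζ : H, η = ρ f ζ} ≤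
      (ℂ ∙ T ξ)ᗮ := by
    refine Submodule.span_le.2 ?_
    rintro _ ⟨f, hf, ζ, rfl⟩
    have hT : ρ (star f) (T ξ) = 0 :=
      DFunLike.congr_fun (h (star f) fun x hx => by simp [hf x hx]) ξ
    rw [SetLike.mem_coe, Submodule.mem_orthogonal_singleton_iff_inner_left,
      ← ContinuousLinearMap.adjoint_inner_right, ← ContinuousLinearMap.star_eq_adjoint,
      ← map_star, hT, inner_zero_right]
  exact fun η hη => Submodule.mem_orthogonal_singleton_iff_inner_left.1 (hle hη)

variable [MeasurableSpace X]

theorem IsControlled.mono {r s : ℝ} (hrs : r ≤ s) {S : H →L[ℂ] H} (hS : IsControlled ρ r S) :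
    IsControlled ρ s S := fun V hV => by
  rw [← hS V hV, ← mul_assoc, chi_mul_of_superset ρ (Metric.cthickening_mono hrs V)]

theorem IsControlled.add {r : ℝ} {S T : H →L[ℂ] H} (hS : IsControlled ρ r S)
    (hT : IsControlled ρ r T) : IsControlled ρ r (S + T) := fun V hV => by
  rw [add_mul, mul_add, hS V hV, hT V hV]

theorem IsControlled.smul {r : ℝ} {S : H →L[ℂ] H} (c : ℂ) (hS : IsControlled ρ r S) :
    IsControlled ρ r (c • S) := fun V hV => by
  rw [smul_mul_assoc, mul_smul_comm, hS V hV]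

theorem IsLocallyCompact.star {T : H →L[ℂ] H} (hT : IsLocallyCompact ρ T) :
    IsLocallyCompact ρ (star T) := fun W hW hb => by
  have hleft := isCompactOperator_star (hT W hW hb).2
  have hright := isCompactOperator_star (hT W hW hb).1
  rw [star_mul, star_chi] at hleft hright
  exact ⟨hleft, hright⟩

theorem HasFinitePropagation.star {T : H →L[ℂ] H} (hT : HasFinitePropagation ρ T) :
    HasFinitePropagation ρ (star T) := by
  obtain ⟨r, hr, h⟩ := hT
  refine ⟨r, hr, fun V W hV hW hVW => ?_⟩
  have hWV : ENNReal.ofReal r < ⨅ y ∈ W, ⨅ x ∈ V, edist y x := by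
    refine hVW.trans_le (le_iInf₂ fun y hy => le_iInf₂ fun x hx => ?_)
    rw [edist_comm]
    exact iInf₂_le_of_le x hx (iInf₂_le y hy)
  have hzero := congrArg Star.star (h W V hW hV hWV)
  rwa [star_mul, star_mul, star_chi, star_chi, star_zero, ← mul_assoc] at hzero

variable [BorelSpace X]

theorem IsControlled.mul {r s : ℝ} (hr : 0 ≤ r) (hs : 0 ≤ s) {S T : H →L[ℂ] H}
    (hS : IsControlled ρ r S) (hT : IsControlled ρ s T) : IsControlled ρ (r + s) (S * T) :=
  fun V hV => by
    have hSV := hS (Metric.cthickening s V) Metric.isClosed_cthickening.measurableSet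
    have hST : S * T * chi ρ V = chi ρ (Metric.cthickening r (Metric.cthickening s V)) *
        (S * chi ρ (Metric.cthickening s V) * (T * chi ρ V)) := by
      rw [← mul_assoc, hSV, mul_assoc S (chi ρ _), hT V hV, mul_assoc]
    rw [hST, ← mul_assoc, chi_mul_of_superset ρ (Metric.cthickening_cthickening_subset hr hs V)]

variable (ρ) in
/-- The ⋆-algebra of locally compact operators `T` such that `T` and `T*` are controlled. -/
def controlledAlgebra : NonUnitalStarSubalgebra ℂ (H →L[ℂ] H) where
  carrier := {T | IsLocallyCompact ρ T ∧
    ∃ r : ℝ, 0 ≤ r ∧ IsControlled ρ r T ∧ IsControlled ρ r (star T)}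
  zero_mem' := by
    refine ⟨fun W _ _ => ?_, 0, le_rfl, fun V _ => by simp, fun V _ => by simp⟩
    rw [mul_zero, zero_mul]
    exact ⟨isCompactOperator_zero, isCompactOperator_zero⟩
  add_mem' {S T} := by
    rintro ⟨cS, r, hr, hS, hS'⟩ ⟨cT, s, -, hT, hT'⟩
    refine ⟨fun W hW hb => ?_, max r s, le_max_of_le_left hr,
      (hS.mono (le_max_left _ _)).add (hT.mono (le_max_right _ _)), ?_⟩
    · rw [mul_add, add_mul]
      exact ⟨(cS W hW hb).1.add (cT W hW hb).1, (cS W hW hb).2.add (cT W hW hb).2⟩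
    · rw [star_add]
      exact (hS'.mono (le_max_left _ _)).add (hT'.mono (le_max_right _ _))
  mul_mem' {S T} := by
    rintro ⟨cS, r, hr, hS, hS'⟩ ⟨cT, s, hs, hT, hT'⟩
    refine ⟨fun W hW hb => ?_, r + s, add_nonneg hr hs, hS.mul hr hs hT, ?_⟩
    · rw [← mul_assoc, mul_assoc S T]
      exact ⟨(cS W hW hb).1.comp_clm T, (cT W hW hb).2.clm_comp S⟩
    · rw [star_mul, add_comm]
      exact hT'.mul hs hr hS'
  smul_mem' c S := by
    rintro ⟨cS, r, hr, hS, hS'⟩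
    refine ⟨fun W hW hb => ?_, r, hr, hS.smul c, ?_⟩
    · rw [mul_smul_comm, smul_mul_assoc]
      exact ⟨(cS W hW hb).1.smul c, (cS W hW hb).2.smul c⟩
    · rw [star_smul]
      exact hS'.smul _
  star_mem' {S} := by
    rintro ⟨cS, r, hr, hS, hS'⟩
    exact ⟨cS.star, r, hr, hS', (star_star S).symm ▸ hS⟩

variable [LocallyCompactSpace X]

theorem HasFinitePropagation.exists_forall_isControlled (hρ : IsNondegenerate ρ)
    {S : H →L[ℂ] H} (hS : HasFinitePropagation ρ S) :
    ∃ r : ℝ, 0 ≤ r ∧ ∀ s > r, IsControlled ρ s S := by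
  obtain ⟨r, hr, h⟩ := hS
  refine ⟨r, hr, fun s hs V hV => ?_⟩
  have hmeas : MeasurableSet (Metric.cthickening s V) := Metric.isClosed_cthickening.measurableSet
  have hdist : ENNReal.ofReal s ≤ ⨅ x ∈ (Metric.cthickening s V)ᶜ, ⨅ y ∈ V, edist x y :=
    le_iInf₂ fun x hx => (not_le.1 (mt Metric.mem_cthickening_iff.2 hx)).le
  have hlt : ENNReal.ofReal r < ENNReal.ofReal s :=
    (ENNReal.ofReal_lt_ofReal_iff (hr.trans_lt hs)).2 hs
  have hzero := h _ V hmeas.compl hV (hlt.trans_le hdist)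
  rw [chi_compl ρ hρ hmeas, sub_mul, sub_mul, one_mul, sub_eq_zero] at hzero
  rw [← mul_assoc, ← hzero]

theorem adjoin_le_controlledAlgebra (hρ : IsNondegenerate ρ) :
    NonUnitalStarAlgebra.adjoin ℂ
      {T : H →L[ℂ] H | IsLocallyCompact ρ T ∧ HasFinitePropagation ρ T} ≤ controlledAlgebra ρ := by
  refine NonUnitalStarAlgebra.adjoin_le ?_
  rintro T ⟨hcompact, hfinite⟩
  obtain ⟨r, hr, hT⟩ := hfinite.exists_forall_isControlled hρ
  obtain ⟨s, -, hT'⟩ := hfinite.star.exists_forall_isControlled hρ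
  exact ⟨hcompact, max r s + 1, by positivity, hT _ (by grind), hT' _ (by grind)⟩

theorem chi_cthickening_mul (hρ : IsNondegenerate ρ) {δ : ℝ} (hδ : 0 < δ) {Z : Set X}
    {T : H →L[ℂ] H} (hT : ∀ f : C₀(X, ℂ), tsupport f ⊆ Zᶜ → ρ f * T = 0) :
    chi ρ (Metric.cthickening δ Z) * T = T := by
  have hmeas : MeasurableSet (Metric.cthickening δ Z) := Metric.isClosed_cthickening.measurableSet
  have hzero : chi ρ (Metric.cthickening δ Z)ᶜ * T = 0 := by
    refine chi_mul_eq_zero Metric.isClosed_cthickening.isOpen_compl fun f hf => hT f ?_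
    have hsupp : tsupport f ⊆ (Metric.thickening δ Z)ᶜ :=
      closure_minimal (fun x hx hxZ => hx (hf x fun hx' =>
        hx' (Metric.thickening_subset_cthickening δ Z hxZ))) Metric.isOpen_thickening.isClosed_compl
    exact hsupp.trans (Set.compl_subset_compl.2 (Metric.self_subset_thickening hδ Z))
  rw [chi_compl ρ hρ hmeas, sub_mul, one_mul, sub_eq_zero] at hzero
  exact hzero.symm

theorem IsSupportedIn.exists_chi_mul_mul_chi (hρ : IsNondegenerate ρ) {Y : Set X} {T : H →L[ℂ] H}
    (hT : IsSupportedIn ρ (coarseBoundary Y) T) :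
    ∃ D ∈ coarseBoundary Y, MeasurableSet D ∧ chi ρ D * T * chi ρ D = T := by
  obtain ⟨Z, hZ, h⟩ := hT
  have hleft := chi_cthickening_mul hρ one_pos fun f hf => (h f hf).1
  have hright : chi ρ (Metric.cthickening 1 Z) * star T = star T := by
    refine chi_cthickening_mul hρ one_pos fun f hf => ?_
    have hstar : tsupport (star f) ⊆ Zᶜ := by
      refine (closure_mono (Function.support_subset_iff'.2 fun x hx => ?_)).trans hf
      simpa using hx
    have hzero := congrArg star (h (star f) hstar).2
    rwa [star_mul, ← map_star, star_star, star_zero] at hzero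
  refine ⟨_, cthickening_mem_coarseBoundary zero_le_one hZ,
    Metric.isClosed_cthickening.measurableSet, ?_⟩
  have hright' := congrArg star hright
  rw [star_mul, star_star, star_chi] at hright'
  rw [hleft, hright']

theorem isCompactOperator_corner (hρ : IsNondegenerate ρ) {Y W D : Set X}
    (hYW : AreTransversal Y W) (hW : MeasurableSet W) (hDY : D ∈ coarseBoundary Y)
    (hD : MeasurableSet D) {S : H →L[ℂ] H} (hS : IsLocallyCompact ρ S) {r : ℝ} (hr : 0 ≤ r)
    (hSr : IsControlled ρ r S) :
    IsCompactOperator ((1 - chi ρ W) * (chi ρ D * S * chi ρ D) * chi ρ W : H →L[ℂ] H) := by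
  -- A controlled operator maps vectors supported in `W` into the `r`-collar `N` of `W`, up to
  -- vectors supported in `W`; transversality makes `D ∩ N` bounded.
  set N := Metric.cthickening r W ∩ Wᶜ with hN
  have hmeas : MeasurableSet (Metric.cthickening r W) := Metric.isClosed_cthickening.measurableSet
  have hbounded : Bornology.IsBounded (D ∩ N) :=
    hYW _ ⟨D, hDY, N, cthickening_inter_compl_mem_coarseBoundary hr W, rfl⟩
  have hcomm : ∀ V, MeasurableSet V → chi ρ V * chi ρ D = chi ρ D * chi ρ V := fun V hV => by
    rw [← chi_inter ρ hρ hD hV, ← chi_inter ρ hρ hV hD, Set.inter_comm]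
  have hcollar : chi ρ Wᶜ * (S * chi ρ W) = chi ρ N * (S * chi ρ W) := by
    rw [← hSr W hW, ← mul_assoc, ← chi_inter ρ hρ hW.compl hmeas, Set.inter_comm, hSr W hW]
  have hcorner : (1 - chi ρ W) * (chi ρ D * S * chi ρ D) * chi ρ W =
      chi ρ (D ∩ N) * S * (chi ρ W * chi ρ D) := by
    calc (1 - chi ρ W) * (chi ρ D * S * chi ρ D) * chi ρ W
        = chi ρ Wᶜ * chi ρ D * S * (chi ρ D * chi ρ W) := by
          rw [chi_compl ρ hρ hW]; simp only [mul_assoc]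
      _ = chi ρ D * (chi ρ Wᶜ * (S * chi ρ W)) * chi ρ D := by
          rw [hcomm _ hW.compl, ← hcomm W hW]; simp only [mul_assoc]
      _ = chi ρ (D ∩ N) * S * (chi ρ W * chi ρ D) := by
          rw [hcollar, chi_inter ρ hρ hD (hmeas.inter hW.compl), hN]; simp only [mul_assoc]
  rw [hcorner]
  exact (hS _ (hD.inter (hmeas.inter hW.compl)) hbounded).1.comp_clm _

theorem chi_mul_mul_chi_mem_essentialCommutant (hρ : IsNondegenerate ρ) {Y W D : Set X}
    (hYW : AreTransversal Y W) (hW : MeasurableSet W) (hDY : D ∈ coarseBoundary Y)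
    (hD : MeasurableSet D) {S : H →L[ℂ] H} (hS : S ∈ controlledAlgebra ρ) :
    chi ρ D * S * chi ρ D ∈
      essentialCommutant (chi ρ W) (isStarProjection_chi ρ W).isSelfAdjoint := by
  obtain ⟨hcompact, r, hr, hSr, hSr'⟩ := hS
  have hstar : star (chi ρ D * S * chi ρ D) = chi ρ D * star S * chi ρ D := by
    rw [star_mul, star_mul, star_chi, mul_assoc]
  refine mem_essentialCommutant_of_corners _
    (isCompactOperator_corner hρ hYW hW hDY hD hcompact hr hSr) ?_
  rw [hstar]
  exact isCompactOperator_corner hρ hYW hW hDY hD hcompact.star hr hSr'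

theorem localizedRoeAlgebra_le_essentialCommutant (hρ : IsNondegenerate ρ) {Y W : Set X}
    (hYW : AreTransversal Y W) (hW : MeasurableSet W) :
    localizedRoeAlgebra ρ (coarseBoundary Y) ≤
      essentialCommutant (chi ρ W) (isStarProjection_chi ρ W).isSelfAdjoint := by
  have hclosed := isClosed_essentialCommutant (isStarProjection_chi ρ W).isSelfAdjoint
  refine NonUnitalStarSubalgebra.topologicalClosure_minimal _
    (NonUnitalStarAlgebra.adjoin_le ?_) hclosed
  rintro T ⟨hT, hsupp⟩
  obtain ⟨D, hDY, hD, hDT⟩ := hsupp.exists_chi_mul_mul_chi hρ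
  have hcut : Continuous fun S : H →L[ℂ] H => chi ρ D * S * chi ρ D := by fun_prop
  have hmem : chi ρ D * T * chi ρ D ∈ essentialCommutant (chi ρ W) _ :=
    closure_minimal (fun S hS => chi_mul_mul_chi_mem_essentialCommutant hρ hYW hW hDY hD
      (adjoin_le_controlledAlgebra hρ hS)) (hclosed.preimage hcut) hT
  rwa [hDT] at hmem

end RoeAlgebra

/-! ### Matrices of operators -/

section BlockOp

variable {E : Type u} [NormedAddCommGroup E] [InnerProductSpace ℂ E] {n m : ℕ}

theorem blockOp_apply (M : Matrix (Fin n) (Fin n) (E →L[ℂ] E)) (x : PiLp 2 fun _ : Fin n => E)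
    (i : Fin n) : blockOp M x i = ∑ j, M i j (x j) := by
  simp [blockOp]

theorem blockOp_diagonal_apply (d : Fin n → E →L[ℂ] E) (x : PiLp 2 fun _ : Fin n => E)
    (i : Fin n) : blockOp (Matrix.diagonal d) x i = d i (x i) := by
  rw [blockOp_apply, Finset.sum_eq_single i, Matrix.diagonal_apply_eq]
  · intro j _ hj
    rw [Matrix.diagonal_apply_ne _ hj.symm, zero_apply]
  · simp

theorem blockOp_one : blockOp (1 : Matrix (Fin n) (Fin n) (E →L[ℂ] E)) = 1 := by
  ext x i
  rw [← Matrix.diagonal_one, blockOp_diagonal_apply]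
  rfl

theorem blockOp_sub (M N : Matrix (Fin n) (Fin n) (E →L[ℂ] E)) :
    blockOp (M - N) = blockOp M - blockOp N := by
  ext x i
  simp only [sub_apply, PiLp.sub_apply, blockOp_apply, Matrix.sub_apply, Finset.sum_sub_distrib]

theorem blockOp_mul (M N : Matrix (Fin n) (Fin n) (E →L[ℂ] E)) :
    blockOp (M * N) = blockOp M * blockOp N := by
  ext x i
  simp only [mul_apply_eq_comp, blockOp_apply, Matrix.mul_apply, map_sum, sum_apply]
  exact Finset.sum_comm

theorem blockOp_star [CompleteSpace E] (M : Matrix (Fin n) (Fin n) (E →L[ℂ] E)) :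
    blockOp (star M) = star (blockOp M) := by
  rw [ContinuousLinearMap.star_eq_adjoint, ContinuousLinearMap.eq_adjoint_iff]
  intro x y
  simp only [PiLp.inner_apply, blockOp_apply, sum_inner, inner_sum, Matrix.star_apply,
    ContinuousLinearMap.star_eq_adjoint, ContinuousLinearMap.adjoint_inner_left]
  exact Finset.sum_comm

theorem blockOp_mem_unitary [CompleteSpace E] {M : Matrix (Fin n) (Fin n) (E →L[ℂ] E)}
    (hM : M ∈ unitary (Matrix (Fin n) (Fin n) (E →L[ℂ] E))) :
    blockOp M ∈ unitary (PiLp 2 (fun _ : Fin n => E) →L[ℂ] PiLp 2 fun _ : Fin n => E) := by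
  rw [Unitary.mem_iff, ← blockOp_star, ← blockOp_mul, ← blockOp_mul,
    Unitary.star_mul_self_of_mem hM, Unitary.mul_star_self_of_mem hM, blockOp_one]
  exact ⟨rfl, rfl⟩

/-- The inclusion of the `i`-th summand of `E^n`. -/
def summandInclusion (i : Fin n) : E →L[ℂ] PiLp 2 fun _ : Fin n => E :=
  ((PiLp.continuousLinearEquiv 2 ℂ fun _ : Fin n => E).symm :
      (Fin n → E) →L[ℂ] PiLp 2 fun _ : Fin n => E) ∘L
    ContinuousLinearMap.single ℂ (fun _ : Fin n => E) i

theorem blockOp_eq_sum (M : Matrix (Fin n) (Fin n) (E →L[ℂ] E)) :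
    blockOp M = ∑ i, ∑ j, summandInclusion i ∘L M i j ∘L PiLp.proj 2 (fun _ : Fin n => E) j := by
  ext x i
  simp [blockOp_apply, summandInclusion, Pi.single_apply]

theorem isCompactOperator_blockOp {M : Matrix (Fin n) (Fin n) (E →L[ℂ] E)}
    (hM : ∀ i j, IsCompactOperator (M i j)) : IsCompactOperator (blockOp M) := by
  rw [blockOp_eq_sum]
  exact Submodule.sum_mem (compactOperator _ _ _) fun i _ =>
    Submodule.sum_mem (compactOperator _ _ _) fun j _ =>
      ((hM i j).comp_clm _).clm_comp (summandInclusion i)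

theorem continuous_blockOp :
    Continuous (blockOp : Matrix (Fin n) (Fin n) (E →L[ℂ] E) → _) := by
  have : ContinuousAdd ((PiLp 2 fun _ : Fin n => E) →L[ℂ] PiLp 2 fun _ : Fin n => E) :=
    IsTopologicalAddGroup.toContinuousAdd
  rw [funext blockOp_eq_sum]
  fun_prop

/-- The inclusion of `E^n` in `E^(n+m)` as the first `n` summands. -/
def blockInclusion (n m : ℕ) :
    (PiLp 2 fun _ : Fin n => E) →ₗ[ℂ] PiLp 2 fun _ : Fin (n + m) => E where
  toFun x := WithLp.toLp 2 (Fin.append x fun _ => 0)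
  map_add' x y := by
    ext k
    induction k using Fin.addCases <;> simp
  map_smul' c x := by
    ext k
    induction k using Fin.addCases <;> simp

/-- The projection of `E^(n+m)` onto the first `n` summands. -/
def blockProjection (n m : ℕ) :
    (PiLp 2 fun _ : Fin (n + m) => E) →ₗ[ℂ] PiLp 2 fun _ : Fin n => E where
  toFun x := WithLp.toLp 2 fun i => x (Fin.castAdd m i)
  map_add' _ _ := rfl
  map_smul' _ _ := rfl

theorem blockProjection_apply (x : PiLp 2 fun _ : Fin (n + m) => E) (i : Fin n) :
    blockProjection n m x i = x (Fin.castAdd m i) := rfl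

theorem blockInclusion_castAdd (x : PiLp 2 fun _ : Fin n => E) (i : Fin n) :
    blockInclusion n m x (Fin.castAdd m i) = x i := by
  simp [blockInclusion]

theorem blockInclusion_natAdd (x : PiLp 2 fun _ : Fin n => E) (i : Fin m) :
    blockInclusion n m x (Fin.natAdd n i) = 0 := by
  simp [blockInclusion]

theorem blockProjection_comp_blockInclusion :
    blockProjection n m ∘ₗ blockInclusion n m = (1 : _ →ₗ[ℂ] PiLp 2 fun _ : Fin n => E) := by
  ext x i
  exact blockInclusion_castAdd x i

theorem blockOp_stabilize_apply (M : Matrix (Fin n) (Fin n) (E →L[ℂ] E))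
    (x : PiLp 2 fun _ : Fin (n + m) => E) :
    blockOp (stabilize (n + m) M) x =
      x + blockInclusion n m (blockOp M (blockProjection n m x) - blockProjection n m x) := by
  ext k
  rw [blockOp_apply, Fin.sum_univ_add, PiLp.add_apply]
  induction k using Fin.addCases with
  | left i =>
    have hne (j : Fin m) : Fin.castAdd m i ≠ Fin.natAdd n j :=
      Fin.ne_of_lt (Nat.lt_add_right j.1 i.2)
    simp [stabilize, blockInclusion_castAdd, blockOp_apply, blockProjection_apply, hne]
  | right i =>
    have hne (j : Fin n) : Fin.natAdd n i ≠ Fin.castAdd m j :=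
      Fin.ne_of_gt (Nat.lt_add_right i.1 j.2)
    have hone (j : Fin m) : (if i = j then 1 else 0 : E →L[ℂ] E) (x (Fin.natAdd n j)) =
        if i = j then x (Fin.natAdd n j) else 0 := by
      split_ifs <;> rfl
    simp [stabilize, blockInclusion_natAdd, hne, hone]

end BlockOp

/-! ### The index map -/

section IndexMap

variable {H : Type u} [NormedAddCommGroup H] [InnerProductSpace ℂ H] [CompleteSpace H]
variable {A : NonUnitalStarSubalgebra ℂ (H →L[ℂ] H)} {n : ℕ}

theorem map_mem_unitary {R S : Type*} [Semiring R] [StarRing R] [Algebra ℂ R] [Semiring S]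
    [StarRing S] [Algebra ℂ S] (φ : R →⋆ₐ[ℂ] S) {M : Matrix (Fin n) (Fin n) R}
    (hM : M ∈ unitary (Matrix (Fin n) (Fin n) R)) :
    M.map φ ∈ unitary (Matrix (Fin n) (Fin n) S) := by
  have hstar : star (M.map φ) = (star M).map φ := by
    ext i j
    exact (map_star φ (M j i)).symm
  rw [Unitary.mem_iff, hstar, ← Matrix.map_mul, ← Matrix.map_mul, Unitary.star_mul_self_of_mem hM,
    Unitary.mul_star_self_of_mem hM, Matrix.map_one _ (map_zero φ) (map_one φ)]
  exact ⟨rfl, rfl⟩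

theorem unitaryOp_mem_unitary (u : UnitaryOver A n) :
    unitaryOp u ∈ unitary (PiLp 2 (fun _ : Fin n => H) →L[ℂ] PiLp 2 fun _ : Fin n => H) :=
  blockOp_mem_unitary (map_mem_unitary _ u.2)

theorem continuous_unitization : Continuous (NonUnitalStarSubalgebra.unitization A) := by
  rw [funext (NonUnitalStarSubalgebra.unitization_apply A)]
  exact ((continuous_algebraMap ℂ _).comp Unitization.continuous_fst).add
    (continuous_subtype_val.comp Unitization.continuous_snd)

theorem map_stabilize {R S : Type u} [Zero R] [One R] [Zero S] [One S] (φ : R → S) (h0 : φ 0 = 0)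
    (h1 : φ 1 = 1) (N : ℕ) (M : Matrix (Fin n) (Fin n) R) :
    (stabilize N M).map φ = stabilize N (M.map φ) := by
  ext i j
  simp only [stabilize, Matrix.map_apply, Matrix.of_apply]
  split_ifs <;> simp only [h0, h1]

variable {X : Type v} [MetricSpace X] (ρ : C₀(X, ℂ) →⋆ₙₐ[ℂ] (H →L[ℂ] H))

theorem chiN_apply (W : Set X) (x : PiLp 2 fun _ : Fin n => H) (i : Fin n) :
    chiN ρ n W x i = chi ρ W (x i) :=
  blockOp_diagonal_apply _ x i

theorem isStarProjection_chiN (n : ℕ) (W : Set X) : IsStarProjection (chiN ρ n W) where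
  isIdempotentElem := by
    rw [IsIdempotentElem, chiN, ← blockOp_mul, Matrix.diagonal_mul_diagonal, chi_mul_self]
  isSelfAdjoint := by
    rw [IsSelfAdjoint, chiN, ← blockOp_star, Matrix.star_eq_conjTranspose,
      Matrix.diagonal_conjTranspose]
    congr 2
    funext _
    exact star_chi ρ W

theorem isCompactOperator_lie_chiN {W : Set X}
    (hA : ∀ a ∈ A, IsCompactOperator (⁅chi ρ W, a⁆ : H →L[ℂ] H)) (u : UnitaryOver A n) :
    IsCompactOperator (⁅chiN ρ n W, unitaryOp u⁆ : _ →L[ℂ] _) := by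
  rw [Ring.lie_def, chiN, unitaryOp, ← blockOp_mul, ← blockOp_mul, ← blockOp_sub]
  refine isCompactOperator_blockOp fun i j => ?_
  have hcompact := hA _ (u.1 i j).snd.2
  rw [Ring.lie_def] at hcompact
  rwa [Matrix.sub_apply, Matrix.diagonal_mul, Matrix.mul_diagonal, Matrix.map_apply,
    NonUnitalStarSubalgebra.unitization_apply, mul_add, add_mul,
    ← Algebra.commutes (u.1 i j).fst (chi ρ W), add_sub_add_left_eq_sub]

theorem chiN_blockInclusion {m : ℕ} (W : Set X) (x : PiLp 2 fun _ : Fin n => H) :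
    chiN ρ (n + m) W (blockInclusion n m x) = blockInclusion n m (chiN ρ n W x) := by
  ext k
  induction k using Fin.addCases with
  | left i => simp only [chiN_apply, blockInclusion_castAdd]
  | right i => simp only [chiN_apply, blockInclusion_natAdd, map_zero]

theorem blockProjection_chiN {m : ℕ} (W : Set X) (x : PiLp 2 fun _ : Fin (n + m) => H) :
    blockProjection n m (chiN ρ (n + m) W x) = chiN ρ n W (blockProjection n m x) := by
  ext i
  simp only [chiN_apply, blockProjection_apply]

theorem fredholmIndex_compression_stabilize {m : ℕ} (W : Set X)
    (M : Matrix (Fin n) (Fin n) (H →L[ℂ] H)) :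
    fredholmIndex (compression (chiN ρ (n + m) W) (blockOp (stabilize (n + m) M))) =
      fredholmIndex (compression (chiN ρ n W) (blockOp M)) := by
  let T : (PiLp 2 fun _ : Fin n => H) →ₗ[ℂ] PiLp 2 fun _ : Fin n => H :=
    (chiN ρ n W * (blockOp M - 1) * chiN ρ n W :)
  have hbig : (compression (chiN ρ (n + m) W) (blockOp (stabilize (n + m) M)) : _ →ₗ[ℂ] _) =
      1 + blockInclusion n m ∘ₗ (T ∘ₗ blockProjection n m) := by
    rw [compression_eq_one_add (isStarProjection_chiN ρ _ W).isIdempotentElem]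
    ext1 x
    have hcut := blockOp_stabilize_apply M (chiN ρ (n + m) W x)
    rw [← sub_eq_iff_eq_add'] at hcut
    have happly :
        (1 + chiN ρ (n + m) W * (blockOp (stabilize (n + m) M) - 1) * chiN ρ (n + m) W) x =
          x + chiN ρ (n + m) W (blockOp (stabilize (n + m) M) (chiN ρ (n + m) W x) -
            chiN ρ (n + m) W x) := rfl
    refine happly.trans ?_
    rw [hcut, chiN_blockInclusion, blockProjection_chiN]
    rfl
  rw [fredholmIndex_eq_linearIndex, fredholmIndex_eq_linearIndex, hbig,
    linearIndex_one_add_comp_comm, LinearMap.comp_assoc, blockProjection_comp_blockInclusion,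
    compression_eq_one_add (isStarProjection_chiN ρ _ W).isIdempotentElem]
  rfl

theorem unitaryOp_eq_blockOp_stabilize {N : ℕ} {u : UnitaryOver A n} {v : UnitaryOver A N}
    (h : v.1 = stabilize N u.1) :
    unitaryOp v = blockOp (stabilize N (u.1.map (NonUnitalStarSubalgebra.unitization A))) := by
  rw [unitaryOp, h, map_stabilize _ (map_zero _) (map_one _)]

variable [MeasurableSpace X] [BorelSpace X] [LocallyCompactSpace X]
variable {ρ} {W : Set X}

theorem toeplitzOp_eq_compression (hρ : IsNondegenerate ρ) (hW : MeasurableSet W)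
    (u : UnitaryOver A n) :
    toeplitzOp ρ W u = compression (chiN ρ n W) (unitaryOp u) := by
  have hcompl : chiN ρ n Wᶜ = 1 - chiN ρ n W := by
    rw [chiN, chi_compl ρ hρ hW, ← Matrix.diagonal_sub, Matrix.diagonal_one, blockOp_sub,
      blockOp_one, chiN]
  rw [toeplitzOp, hcompl, compression]

theorem fredholmIndex_toeplitzOp_stabilize (hρ : IsNondegenerate ρ) (hW : MeasurableSet W)
    {N : ℕ} {u : UnitaryOver A n} {v : UnitaryOver A N} (hN : n ≤ N) (h : v.1 = stabilize N u.1) :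
    fredholmIndex (toeplitzOp ρ W v) = fredholmIndex (toeplitzOp ρ W u) := by
  obtain ⟨m, rfl⟩ := Nat.exists_eq_add_of_le hN
  rw [toeplitzOp_eq_compression hρ hW, toeplitzOp_eq_compression hρ hW,
    unitaryOp_eq_blockOp_stabilize h, fredholmIndex_compression_stabilize, unitaryOp]

theorem exists_isParametrix_toeplitzOp (hρ : IsNondegenerate ρ) (hW : MeasurableSet W)
    (hA : ∀ a ∈ A, IsCompactOperator (⁅chi ρ W, a⁆ : H →L[ℂ] H)) (u : UnitaryOver A n) :
    ∃ S, IsParametrix S (toeplitzOp ρ W u) := by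
  rw [toeplitzOp_eq_compression hρ hW]
  exact ⟨_, isParametrix_compression_star (isStarProjection_chiN ρ n W) (unitaryOp_mem_unitary u)
    (isCompactOperator_lie_chiN ρ hA u)⟩

theorem fredholmIndex_toeplitzOp_eq_of_path (hρ : IsNondegenerate ρ) (hW : MeasurableSet W)
    (hA : ∀ a ∈ A, IsCompactOperator (⁅chi ρ W, a⁆ : H →L[ℂ] H))
    {w : unitInterval → UnitaryOver A n} (hw : Continuous fun t => unitaryOp (w t)) :
    fredholmIndex (toeplitzOp ρ W (w 0)) = fredholmIndex (toeplitzOp ρ W (w 1)) := by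
  have hF : Continuous fun t => toeplitzOp ρ W (w t) := by
    simp only [toeplitzOp]
    fun_prop
  choose S hS using fun t => exists_isParametrix_toeplitzOp hρ hW hA (w t)
  exact IsParametrix.fredholmIndex_eq_of_path (T := fun t => toeplitzOp ρ W (w t)) hS hF

theorem fredholmIndex_toeplitzOp_eq_of_stablyHomotopic (hρ : IsNondegenerate ρ)
    (hW : MeasurableSet W) (hA : ∀ a ∈ A, IsCompactOperator (⁅chi ρ W, a⁆ : H →L[ℂ] H))
    {u v : Σ n : ℕ, UnitaryOver A n} (h : StablyHomotopic A u v) :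
    fredholmIndex (toeplitzOp ρ W u.2) = fredholmIndex (toeplitzOp ρ W v.2) := by
  obtain ⟨N, hu, hv, γ, hγ, h0, h1⟩ := h
  let w : unitInterval → UnitaryOver A N := fun t => ⟨γ t, hγ t⟩
  have hw : Continuous fun t => unitaryOp (w t) :=
    continuous_blockOp.comp (γ.continuous.matrix_map continuous_unitization)
  rw [← fredholmIndex_toeplitzOp_stabilize hρ hW hu (v := w 0) h0,
    ← fredholmIndex_toeplitzOp_stabilize hρ hW hv (v := w 1) h1]
  exact fredholmIndex_toeplitzOp_eq_of_path hρ hW hA hw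

theorem theta_mk (hρ : IsNondegenerate ρ) (hW : MeasurableSet W)
    (hA : ∀ a ∈ A, IsCompactOperator (⁅chi ρ W, a⁆ : H →L[ℂ] H)) (u : UnitaryOver A n) :
    theta ρ W A (K1.mk u) = fredholmIndex (toeplitzOp ρ W u) := by
  let ind : K1 A → ℤ := Quot.lift (fun v => fredholmIndex (toeplitzOp ρ W v.2))
    fun _ _ h => fredholmIndex_toeplitzOp_eq_of_stablyHomotopic hρ hW hA h
  exact congrArg ind (Quot.out_eq (K1.mk u))

end IndexMap

end RoeKubo

end

theorem mainTheorem5_general {X : Type v} [MetricSpace X] [LocallyCompactSpace X]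
    [MeasurableSpace X] [BorelSpace X]
    {H : Type u} [NormedAddCommGroup H] [InnerProductSpace ℂ H] [CompleteSpace H]
    (ρ : C₀(X, ℂ) →⋆ₙₐ[ℂ] (H →L[ℂ] H)) (hρ : RoeKubo.IsNondegenerate ρ)
    {W : Set X} (hW : MeasurableSet W) {A : NonUnitalStarSubalgebra ℂ (H →L[ℂ] H)}
    (hA : ∀ a ∈ A, IsCompactOperator (⁅RoeKubo.chi ρ W, a⁆ : H →L[ℂ] H))
    {n : ℕ} (u : RoeKubo.UnitaryOver A n) :
    RoeKubo.IsFredholm (RoeKubo.toeplitzOp ρ W u) ∧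
    RoeKubo.theta ρ W A (RoeKubo.K1.mk u) = RoeKubo.fredholmIndex (RoeKubo.toeplitzOp ρ W u) ∧
    (RoeKubo.IsTraceClass
        (RoeKubo.unitaryOp u * ⁅RoeKubo.chiN ρ n W, star (RoeKubo.unitaryOp u)⁆) →
      RoeKubo.HasTrace
        (RoeKubo.unitaryOp u * ⁅RoeKubo.chiN ρ n W, star (RoeKubo.unitaryOp u)⁆)
        (RoeKubo.theta ρ W A (RoeKubo.K1.mk u) : ℂ)) := by
  obtain ⟨S, hS⟩ := RoeKubo.exists_isParametrix_toeplitzOp hρ hW hA u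
  have htheta := RoeKubo.theta_mk hρ hW hA u
  refine ⟨hS.isFredholm, htheta, fun hT => ?_⟩
  rw [htheta, RoeKubo.toeplitzOp_eq_compression hρ hW]
  exact RoeKubo.hasTrace_mul_lie_star (RoeKubo.isStarProjection_chiN ρ n W)
    (RoeKubo.unitaryOp_mem_unitary u) hT

theorem mainTheorem5 {X : Type v} [MetricSpace X] [ProperSpace X] [MeasurableSpace X] [BorelSpace X]
    {H : Type u} [NormedAddCommGroup H] [InnerProductSpace ℂ H] [CompleteSpace H]
    (ρ : C₀(X, ℂ) →⋆ₙₐ[ℂ] (H →L[ℂ] H))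
    (hρ : RoeKubo.IsNondegenerate ρ) (hample : RoeKubo.IsAmple ρ)
    (Y W : Set X) (hY : MeasurableSet Y) (hW : MeasurableSet W)
    (hYW : RoeKubo.AreTransversal Y W)
    (n : ℕ)
    (u : RoeKubo.UnitaryOver (RoeKubo.localizedRoeAlgebra ρ (RoeKubo.coarseBoundary Y)) n) :
    RoeKubo.IsFredholm (RoeKubo.toeplitzOp ρ W u) ∧
    RoeKubo.theta ρ W (RoeKubo.localizedRoeAlgebra ρ (RoeKubo.coarseBoundary Y)) (RoeKubo.K1.mk u) =
      RoeKubo.fredholmIndex (RoeKubo.toeplitzOp ρ W u) ∧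
    (RoeKubo.IsTraceClass
        (RoeKubo.unitaryOp u * ⁅RoeKubo.chiN ρ n W, star (RoeKubo.unitaryOp u)⁆) →
      RoeKubo.HasTrace
        (RoeKubo.unitaryOp u * ⁅RoeKubo.chiN ρ n W, star (RoeKubo.unitaryOp u)⁆)
        (RoeKubo.theta ρ W (RoeKubo.localizedRoeAlgebra ρ (RoeKubo.coarseBoundary Y))
          (RoeKubo.K1.mk u) : ℂ)) := by
  exact mainTheorem5_general ρ hρ hW
    (fun _ ha => RoeKubo.localizedRoeAlgebra_le_essentialCommutant hρ hYW hW ha) u
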